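/- Let $d\ge 2$, $\lambda>0$, and let $S$ be a homogeneous Poisson process of rate $\lambda$ on $\mathbb R^{d-1}\times\mathbb R$. Let $B(x)\subset\mathbb R^{d-1}$ be the closed Euclidean unit ball centred at $x$, and let $\mathcal S_{d-1}$ be the set of locally finite subsets (configurations) of $\mathbb R^{d-1}$, with the $\sigma$-algebra generated by the numbers of points in Borel sets. A walk started at $(x,r)$ stays at $x$ until the first time $r'>r$ such that $(x',r')\in S$ for some $x'$ with $x\in B(x')$; at time $r'$ it jumps to $x'$, and it continues from $(x',r')$ in the same way. For $\eta\in\mathcal S_{d-1}$ and $t\ge 0$ let $\eta^{\eta}_t$ be the set of positions at time $t$ of all walks started from the points $(x,0)$, $x\in\eta$, and from the points $(x,r)\in S$ with $0\le r\le t$. Let $\eta_0$ be the set of positions at time $0$ of all walks started from the points $(x,r)\in S$ with $r\le 0$. Put $P_tf(\eta)=\mathbb E[f(\eta^\eta_t)]$ and $E[f]=\mathbb E[f(\eta_0)]$. A function $f:\mathcal S_{d-1}\to\mathbb R$ has finite support if there is a bounded set $\Lambda\subset\mathbb R^{d-1}$ such that $f(\eta)$ depends only on $\eta\cap\Lambda$.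 Then $\{P_t: t\ge 0\}$ is the semigroup associated to the generator $$Lf(\eta)=\lambda\int_{\mathbb R^{d-1}}\big[f\big((\eta\setminus B(u))\cup\{u\}\big)-f(\eta)\big]\,du ,$$ that is, for bounded measurable $f$ of finite support, $P_tf$ is again such a function, $P_0f=f$, $P_{s+t}f=P_sP_tf$ for $s,t\ge 0$, and $h^{-1}(P_hf-f)\to Lf$ uniformly on $\mathcal S_{d-1}$ as $h\downarrow 0$. The law of $\eta_0$ is the unique probability measure on $\mathcal S_{d-1}$ that is invariant for $\{P_t\}$ (i.e. under which $P_tf$ and $f$ have the same expectation for all such $f$ and all $t\ge0$). Moreover, the system converges exponentially fast to this invariant measure: there is a constant $C_d>0$ depending only on $d$ and, for every bounded measurable $f:\mathcal S_{d-1}\to\mathbb R$ of finite support, a finite constant $C(f)$ depending only on $f$ and $d$, such that $$\big\|P_tf-E[f]\big\|_\infty=\sup_{\eta\in\mathcal S_{d-1}}\big|P_tf(\eta)-E[f]\big|\le C(f)\,e^{-C_d\lambda t}\qquad\text{for every } t\ge 0 .$$ -/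

import Mathlib

open MeasureTheory ProbabilityTheory Filter Topology Bornology
open scoped NNReal

namespace PoissonTree

/-- Locally finite (unlabelled) configurations of points of `X`: subsets that meet every bounded
set in finitely many points. -/
def Conf (X : Type*) [PseudoMetricSpace X] : Type _ :=
  {η : Set X // ∀ K : Set X, IsBounded K → (η ∩ K).Finite}

/-- The usual σ-algebra on configurations, generated by the numbers of points in Borel sets. -/
noncomputable instance Conf.instMeasurableSpace (X : Type*) [PseudoMetricSpace X] [MeasurableSpace X] :
    MeasurableSpace (Conf X) :=
  ⨆ (A : Set X) (_ : MeasurableSet A),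
    MeasurableSpace.comap (fun η : Conf X => (η.1 ∩ A).encard) ⊤

open Classical in
/-- A locally finite set, regarded as a configuration (a set that is not locally finite is sent
to the empty configuration). -/
noncomputable def Conf.ofSet {X : Type*} [PseudoMetricSpace X] (s : Set X) : Conf X :=
  if h : ∀ K : Set X, IsBounded K → (s ∩ K).Finite then ⟨s, h⟩
  else ⟨∅, fun K _ => by simp⟩

/-- `S` is a homogeneous Poisson process of rate `lam` on `X`, defined on `(Ω, P)`: the numbers of
points in bounded Borel sets are Poisson distributed with mean `lam` times the volume, and the
numbers of points in disjoint bounded Borel sets are independent. -/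
structure IsPoissonProcess {X : Type*} [PseudoMetricSpace X] [MeasureSpace X]
    {Ω : Type*} [MeasurableSpace Ω] (lam : ℝ) (S : Ω → Conf X) (P : Measure Ω) : Prop where
  measurable : Measurable S
  law_count : ∀ A : Set X, MeasurableSet A → IsBounded A →
    P.map (fun ω => ((S ω).1 ∩ A).ncard)
      = poissonMeasure (Real.toNNReal lam * (volume A).toNNReal)
  indep_count : ∀ (k : ℕ) (A : Fin k → Set X), (∀ i, MeasurableSet (A i)) →
    (∀ i, IsBounded (A i)) → Pairwise (fun i j => Disjoint (A i) (A j)) →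
    iIndepFun (fun (i : Fin k) (ω : Ω) => ((S ω).1 ∩ A i).ncard) P

/-- The space `ℝ^(d-1)`, with the Euclidean norm. A point `s = (x, r)` of `Space d × ℝ` has the
space coordinate `s.1 = x` and the time coordinate `s.2 = r`. -/
abbrev Space (d : ℕ) : Type := EuclideanSpace ℝ (Fin (d - 1))

/-- The times at which the ray `{(x, t) : t > r}` emitted by `s = (x, r)` meets an obstacle
`B(x') × {r'}`, `(x', r') ∈ S`, where `B(x')` is the closed unit ball centred at `x'`. -/
def hitTimes {d : ℕ} (S : Set (Space d × ℝ)) (s : Space d × ℝ) : Set ℝ :=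
  {t | s.2 < t ∧ ∃ x' : Space d, (x', t) ∈ S ∧ s.1 ∈ Metric.closedBall x' 1}

/-- `s'` is a mother of `s`: the centre of the first obstacle met by the ray emitted by `s`. -/
def IsMother {d : ℕ} (S : Set (Space d × ℝ)) (s s' : Space d × ℝ) : Prop :=
  s' ∈ S ∧ s.1 ∈ Metric.closedBall s'.1 1 ∧ IsLeast (hitTimes S s) s'.2

open Classical in
/-- The mother `α(s, S)` of `s` (and `s` itself if the ray meets no obstacle). -/
noncomputable def mother {d : ℕ} (S : Set (Space d × ℝ)) (s : Space d × ℝ) : Space d × ℝ :=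
  if h : ∃ s', IsMother S s s' then h.choose else s

/-- `X^s_t = y`: the walk started at `s = (x, r)` is at `y` at time `t ≥ r`. This means that for
some `n` the `n`-th ancestor `α^n(s)` has space coordinate `y`, its time coordinate (the time of
the `n`-th jump) is at most `t`, and the next obstacle is met only after time `t`. -/
def WalkAt {d : ℕ} (S : Set (Space d × ℝ)) (s : Space d × ℝ) (t : ℝ) (y : Space d) : Prop :=
  ∃ n : ℕ, ((mother S)^[n] s).1 = y ∧ ((mother S)^[n] s).2 ≤ t ∧
    ∀ u ∈ hitTimes S ((mother S)^[n] s), t < u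

/-- The set `η^{η,t'}_t` of positions at time `t` of the walks started from the points of `S`
with time coordinate in `[t', t]` and from the points of `η` at time `t'`. -/
def processFrom {d : ℕ} (S : Set (Space d × ℝ)) (η : Set (Space d)) (t' t : ℝ) :
    Set (Space d) :=
  {y | ∃ s : Space d × ℝ, ((s ∈ S ∧ t' ≤ s.2 ∧ s.2 ≤ t) ∨ (s.1 ∈ η ∧ s.2 = t')) ∧
    WalkAt S s t y}

/-- The set `η_t` of positions at time `t` of all walks started from points of `S` with time
coordinate at most `t`. -/
def processAt {d : ℕ} (S : Set (Space d × ℝ)) (t : ℝ) : Set (Space d) :=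
  {y | ∃ s ∈ S, s.2 ≤ t ∧ WalkAt S s t y}

/-- `P_t f (η) = 𝔼 [f (η^{η,0}_t)]`. -/
noncomputable def semigroup {d : ℕ} {Ω : Type*} [MeasurableSpace Ω] (P : Measure Ω)
    (S : Ω → Conf (Space d × ℝ)) (t : ℝ) (f : Conf (Space d) → ℝ) (η : Conf (Space d)) : ℝ :=
  ∫ ω, f (Conf.ofSet (processFrom (S ω).1 η.1 0 t)) ∂P

/-- The law of `η_0`. -/
noncomputable def stationaryState {d : ℕ} {Ω : Type*} [MeasurableSpace Ω] (P : Measure Ω)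
    (S : Ω → Conf (Space d × ℝ)) : Measure (Conf (Space d)) :=
  P.map (fun ω => Conf.ofSet (processAt (S ω).1 0))

/-- Bounded (measurable) functions of finite support, that is, functions that depend on the
configuration only through its points in some bounded region. -/
structure IsBoundedLocal {d : ℕ} (f : Conf (Space d) → ℝ) : Prop where
  measurable : Measurable f
  bounded : ∃ M : ℝ, ∀ η, |f η| ≤ M
  finite_support : ∃ Λ : Set (Space d), IsBounded Λ ∧
    ∀ η ξ : Conf (Space d), η.1 ∩ Λ = ξ.1 ∩ Λ → f η = f ξ

/-- The configuration `(η \ B(u)) ∪ {u}`. -/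
noncomputable def update {d : ℕ} (η : Conf (Space d)) (u : Space d) : Conf (Space d) :=
  ⟨(η.1 \ Metric.closedBall u 1) ∪ {u}, fun K hK =>
    ((η.2 K hK).union (Set.finite_singleton u)).subset (by
      rintro y ⟨hy | hy, hyK⟩
      · exact Or.inl ⟨hy.1, hyK⟩
      · exact Or.inr hy)⟩

/-- The generator `L f (η) = lam * ∫ [f ((η \ B(u)) ∪ {u}) - f η] du`. -/
noncomputable def generator {d : ℕ} (lam : ℝ) (f : Conf (Space d) → ℝ) (η : Conf (Space d)) : ℝ :=
  lam * ∫ u : Space d, (f (update η u) - f η)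

/-- `(T t)`, `t ≥ 0`, is a semigroup of operators on the bounded functions of finite support whose
derivative at time zero, in the supremum norm, is `L`. -/
structure IsSemigroupWithGenerator {d : ℕ}
    (T : ℝ → (Conf (Space d) → ℝ) → (Conf (Space d) → ℝ))
    (L : (Conf (Space d) → ℝ) → (Conf (Space d) → ℝ)) : Prop where
  maps_to : ∀ f, IsBoundedLocal f → ∀ t, 0 ≤ t → IsBoundedLocal (T t f)
  zero : ∀ f, IsBoundedLocal f → T 0 f = f
  add : ∀ f, IsBoundedLocal f → ∀ s t, 0 ≤ s → 0 ≤ t → T (s + t) f = T s (T t f)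
  deriv : ∀ f, IsBoundedLocal f →
    TendstoUniformly (fun (h : ℝ) (η : Conf (Space d)) => (T h f η - f η) / h) (L f) (𝓝[>] 0)

/-- `μ` is a stationary (invariant) probability measure for `(T t)`, `t ≥ 0`. -/
structure IsStationary {d : ℕ} (T : ℝ → (Conf (Space d) → ℝ) → (Conf (Space d) → ℝ))
    (μ : Measure (Conf (Space d))) : Prop where
  isProbabilityMeasure : IsProbabilityMeasure μ
  invariant : ∀ f, IsBoundedLocal f → ∀ t, 0 ≤ t → ∫ η, T t f η ∂μ = ∫ η, f η ∂μ

end PoissonTree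

/-!
Unwinding the walks from time `t` backwards, a point `y` is occupied at time `t` exactly when it
was occupied or created at some earlier time and no point of the Poisson process within distance
one of `y` has arrived since. Hence as soon as every `y ∈ Λ` lies in a ball that arrived during
`(0, t]`, the configuration inside `Λ` has forgotten the initial condition and agrees with the
process started at time `-∞`. Covering `Λ` by finitely many balls of radius `1 / 2`, each of which
fails to receive a point with probability `exp (-(|ball| * lam * t))`, gives the exponential rate;
stationarity and uniqueness follow.

For the generator, the points arriving near `Λ` during `(0, h]` are replaced by separate single
updates. The replacement is exact unless at least two points arrive, so the error is controlled by
the second factorial moment `(lam * |W| * h) ^ 2`, while Campbell's formula evaluates the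
expectation of the approximation as `f η + h * generator lam f η`.
-/

namespace PoissonTree

/-! ### Random configurations -/

section Configurations

variable {X α : Type*} [MeasurableSpace X] [MeasurableSpace α]

section PseudoMetricSpace

variable [PseudoMetricSpace X]

omit [MeasurableSpace X] in
lemma Conf.finite_inter (η : Conf X) {K : Set X} (hK : IsBounded K) : (η.1 ∩ K).Finite :=
  η.2 K hK

omit [MeasurableSpace X] in
lemma Conf.ofSet_val {s : Set X} (h : ∀ K : Set X, IsBounded K → (s ∩ K).Finite) :
    (Conf.ofSet s).1 = s :=
  congrArg Subtype.val (dif_pos h : Conf.ofSet s = ⟨s, h⟩)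

omit [MeasurableSpace X] in
lemma Conf.countable (η : Conf X) : η.1.Countable := by
  obtain hX | ⟨⟨x₀⟩⟩ := isEmpty_or_nonempty X
  · exact η.1.to_countable
  · rw [← Set.inter_univ η.1, ← Metric.iUnion_closedBall_nat x₀, Set.inter_iUnion]
    exact Set.countable_iUnion fun n => (η.finite_inter Metric.isBounded_closedBall).countable

lemma Conf.measurable_encard {A : Set X} (hA : MeasurableSet A) :
    Measurable fun η : Conf X => (η.1 ∩ A).encard := by
  rw [measurable_iff_comap_le]
  exact le_iSup₂ (f := fun (A : Set X) (_ : MeasurableSet A) =>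
    MeasurableSpace.comap (fun η : Conf X => (η.1 ∩ A).encard) ⊤) A hA

lemma Conf.measurableSet_void {A : Set X} (hA : MeasurableSet A) :
    MeasurableSet {η : Conf X | η.1 ∩ A = ∅} := by
  convert Conf.measurable_encard hA (measurableSet_singleton 0) using 1
  ext η
  simp

variable [MeasurableSingletonClass X]

lemma Conf.measurableSet (η : Conf X) : MeasurableSet η.1 := η.countable.measurableSet

lemma Conf.count_restrict_apply (η : Conf X) {A : Set X} (hA : MeasurableSet A) :
    Measure.count.restrict η.1 A = ((η.1 ∩ A).encard : ENNReal) := by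
  rw [Measure.restrict_apply hA, Measure.count_apply (hA.inter η.measurableSet), Set.inter_comm]

/-- A configuration `η`, viewed as the point measure `∑ x ∈ η, δ_x`. -/
noncomputable def countKernel (X : Type*) [PseudoMetricSpace X] [MeasurableSpace X]
    [MeasurableSingletonClass X] : Kernel (Conf X) X where
  toFun η := Measure.count.restrict η.1
  measurable' := Measure.measurable_of_measurable_coe _ fun A hA => by
    simp only [Conf.count_restrict_apply _ hA]
    exact (measurable_of_countable _).comp (Conf.measurable_encard hA)

lemma countKernel_apply (η : Conf X) {A : Set X} (hA : MeasurableSet A) :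
    countKernel X η A = ((η.1 ∩ A).encard : ENNReal) :=
  η.count_restrict_apply hA

lemma countKernel_lt_top (η : Conf X) {A : Set X} (hA : MeasurableSet A) (hA' : IsBounded A) :
    countKernel X η A < ⊤ := by
  simpa [countKernel_apply η hA, Set.encard_lt_top_iff] using η.finite_inter hA'

lemma Conf.measurableSet_void_section [OpensMeasurableSpace X] {g : α → Conf X}
    (hg : Measurable g) {D : Set (α × X)} (hD : MeasurableSet D) :
    MeasurableSet {a | ∀ x ∈ (g a).1, (a, x) ∉ D} := by
  obtain hX | ⟨⟨x₀⟩⟩ := isEmpty_or_nonempty X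
  · simp
  have hball (n : ℕ) : MeasurableSet (Metric.closedBall x₀ n) := measurableSet_closedBall
  let κ (n : ℕ) : Kernel α X := ((countKernel X).restrict (hball n)).comap g hg
  have hκ_apply (n : ℕ) (a : α) :
      κ n a (Prod.mk a ⁻¹' D) = 0 ↔ ∀ x ∈ (g a).1, x ∈ Metric.closedBall x₀ n → (a, x) ∉ D := by
    rw [Kernel.comap_apply, Kernel.restrict_apply' _ _ _ (measurable_prodMk_left hD),
      countKernel_apply _ ((measurable_prodMk_left hD).inter (hball n))]
    simp only [ENat.toENNReal_eq_zero, Set.encard_eq_zero, Set.eq_empty_iff_forall_notMem,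
      Set.mem_inter_iff, Set.mem_preimage]
    grind
  have hκ_finite (n : ℕ) (a : α) : IsFiniteMeasure (κ n a) :=
    ⟨by simpa [κ, Kernel.comap_apply, Kernel.restrict_apply] using
      countKernel_lt_top (g a) (hball n) Metric.isBounded_closedBall⟩
  have h_inter : {a | ∀ x ∈ (g a).1, (a, x) ∉ D} = ⋂ n, {a | κ n a (Prod.mk a ⁻¹' D) = 0} := by
    ext a
    simp only [hκ_apply, Set.mem_ofPred_eq, Set.mem_iInter]
    refine ⟨fun h _ x hx _ => h x hx, fun h x hx => ?_⟩
    obtain ⟨n, hn⟩ := exists_nat_ge (dist x x₀)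
    exact h n x hx hn
  rw [h_inter]
  exact MeasurableSet.iInter fun n =>
    Kernel.measurable_kernel_prodMk_left_of_finite hD (hκ_finite n) (measurableSet_singleton 0)

end PseudoMetricSpace

section MetricSpace

variable [MetricSpace X]

/-- The events that a configuration has no point in a given bounded Borel set. -/
def voidEvents (X : Type*) [MetricSpace X] [MeasurableSpace X] : Set (Set (Conf X)) :=
  {E | ∃ A : Set X, MeasurableSet A ∧ IsBounded A ∧ E = {η | η.1 ∩ A = ∅}}

lemma isPiSystem_voidEvents : IsPiSystem (voidEvents X) := by
  rintro _ ⟨A, hA, hA', rfl⟩ _ ⟨B, hB, hB', rfl⟩ -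
  refine ⟨A ∪ B, hA.union hB, hA'.union hB', ?_⟩
  ext η
  simp [Set.inter_union_distrib_left]

variable [SecondCountableTopology X]

/-- The bounded members of a countable basis of the topology. Counting points of a configuration
amounts to finding disjoint members of this basis that contain points. -/
def boundedBasis (X : Type*) [MetricSpace X] [SecondCountableTopology X] : Set (Set X) :=
  {U ∈ TopologicalSpace.countableBasis X | IsBounded U}

omit [MeasurableSpace X] in
lemma le_encard_inter_iff (η A : Set X) (m : ℕ) :
    (m : ℕ∞) ≤ (η ∩ A).encard ↔ ∃ s : Finset (boundedBasis X), s.card = m ∧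
      (s : Set (boundedBasis X)).PairwiseDisjoint Subtype.val ∧
      ∀ U ∈ s, (η ∩ (A ∩ U.1)).Nonempty := by
  classical
  constructor
  · intro h
    obtain ⟨t, htA, htm⟩ := Set.exists_subset_encard_eq h
    have htf : t.Finite := Set.finite_of_encard_eq_coe htm
    obtain ⟨V, hV, hVd⟩ := htf.t2_separation
    have h_basis (x : X) : ∃ U : boundedBasis X, x ∈ U.1 ∧ U.1 ⊆ V x := by
      obtain ⟨U, hU, hxU, hUV⟩ := (TopologicalSpace.isBasis_countableBasis X).mem_nhds_iff.1
        (((hV x).2.inter Metric.isOpen_ball).mem_nhds ⟨(hV x).1, Metric.mem_ball_self one_pos⟩)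
      exact ⟨⟨U, hU, Metric.isBounded_ball.subset fun y hy => (hUV hy).2⟩, hxU,
        fun y hy => (hUV hy).1⟩
    choose U hxU hUV using h_basis
    have hUd : t.PairwiseDisjoint fun x => (U x).1 := hVd.mono_on fun x _ => hUV x
    have hU_inj : Set.InjOn U t := fun x hx y hy hxy =>
      hUd.elim_set hx hy x (hxU x) (hxy ▸ hxU x)
    refine ⟨htf.toFinset.image U, ?_, ?_, ?_⟩
    · rw [Finset.card_image_of_injOn (by simpa using hU_inj)]
      rw [htf.encard_eq_coe_toFinset_card] at htm
      exact_mod_cast htm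
    · rw [Finset.coe_image, Set.Finite.coe_toFinset]
      exact hU_inj.pairwiseDisjoint_image.2 hUd
    · simp only [Finset.mem_image, Set.Finite.mem_toFinset, forall_exists_index, and_imp,
        forall_apply_eq_imp_iff₂]
      exact fun x hx => ⟨x, (htA hx).1, (htA hx).2, hxU x⟩
  · rintro ⟨s, rfl, hs, hne⟩
    choose p hp using fun U : s => hne U.1 U.2
    have hp_inj : Function.Injective p := fun U V hUV =>
      Subtype.ext (hs.elim_set U.2 V.2 (p U) (hp U).2.2 (hUV ▸ (hp V).2.2))
    calc (s.card : ℕ∞) = ENat.card s := by simp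
      _ ≤ (Set.range p).encard := hp_inj.encard_range
      _ ≤ (η ∩ A).encard :=
        Set.encard_le_encard (Set.range_subset_iff.2 fun U => ⟨(hp U).1, (hp U).2.1⟩)

variable [BorelSpace X]

lemma Conf.measurableSpace_eq_generateFrom_void :
    Conf.instMeasurableSpace X = MeasurableSpace.generateFrom (voidEvents X) := by
  refine le_antisymm (iSup₂_le fun A hA => ?_) (MeasurableSpace.generateFrom_le ?_)
  · rw [← measurable_iff_comap_le]
    let : MeasurableSpace (Conf X) := MeasurableSpace.generateFrom (voidEvents X)
    have : Countable (boundedBasis X) :=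
      ((TopologicalSpace.countable_countableBasis X).mono fun _ hU => hU.1).to_subtype
    have h_nonempty (U : boundedBasis X) :
        MeasurableSet {η : Conf X | (η.1 ∩ (A ∩ U.1)).Nonempty} := by
      have hU : MeasurableSet U.1 :=
        (TopologicalSpace.isOpen_of_mem_countableBasis U.2.1).measurableSet
      simpa only [Set.compl_ofPred, ← ne_eq, ← Set.nonempty_iff_ne_empty] using
        (MeasurableSpace.measurableSet_generateFrom
          ⟨A ∩ U.1, hA.inter hU, U.2.2.subset Set.inter_subset_right, rfl⟩ :
          MeasurableSet {η : Conf X | η.1 ∩ (A ∩ U.1) = ∅}).compl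
    have h_le (m : ℕ) : MeasurableSet {η : Conf X | (m : ℕ∞) ≤ (η.1 ∩ A).encard} := by
      simp only [le_encard_inter_iff, Set.ofPred_exists, Set.ofPred_and, Set.ofPred_forall]
      exact .iUnion fun s => (MeasurableSet.const _).inter <| (MeasurableSet.const _).inter <|
        .iInter fun U => .iInter fun _ => h_nonempty U
    refine ENat.measurable_iff.2 fun n => ?_
    convert (h_le n).diff (h_le (n + 1)) using 1
    ext η
    simp only [Set.mem_preimage, Set.mem_singleton_iff, Set.mem_sdiff, Set.mem_ofPred_eq, not_le,
      Nat.cast_add, Nat.cast_one, ENat.lt_add_one_iff (ENat.natCast_ne_top n)]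
    rw [le_antisymm_iff, and_comm]
  · rintro _ ⟨A, hA, -, rfl⟩
    exact Conf.measurableSet_void hA

lemma Conf.measurable_of_void {g : α → Conf X}
    (h : ∀ A : Set X, MeasurableSet A → IsBounded A → MeasurableSet {a | (g a).1 ∩ A = ∅}) :
    Measurable g := by
  rw [Conf.measurableSpace_eq_generateFrom_void (X := X)]
  refine measurable_generateFrom ?_
  rintro _ ⟨A, hA, hA', rfl⟩
  exact h A hA hA'

lemma Conf.measure_ext {μ ν : Measure (Conf X)} [IsProbabilityMeasure μ] [IsProbabilityMeasure ν]
    (h : ∀ A : Set X, MeasurableSet A → IsBounded A →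
      μ.real {η | η.1 ∩ A = ∅} = ν.real {η | η.1 ∩ A = ∅}) : μ = ν := by
  refine ext_of_generate_finite (voidEvents X) Conf.measurableSpace_eq_generateFrom_void
    isPiSystem_voidEvents ?_ (by simp)
  rintro _ ⟨A, hA, hA', rfl⟩
  exact (measureReal_eq_measureReal_iff).1 (h A hA hA')

end MetricSpace

end Configurations

/-! ### Configurations in space-time -/

section SpaceTime

variable {X : Type*} [MetricSpace X]

lemma isometry_add_time (c : ℝ) : Isometry fun p : X × ℝ => (p.1, p.2 + c) :=
  isometry_id.prodMap (isometry_add_right c)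

/-- The configuration `S` seen from time `c`, that is, translated in time by `-c`. -/
def timeShift (c : ℝ) (S : Conf (X × ℝ)) : Conf (X × ℝ) :=
  ⟨{p | (p.1, p.2 + c) ∈ S.1}, fun K hK => by
    have hc := isometry_add_time (X := X) c
    exact ((S.finite_inter (hc.lipschitz.isBounded_image hK)).preimage hc.injective.injOn).subset
      fun p hp => ⟨hp.1, Set.mem_image_of_mem _ hp.2⟩⟩

lemma mem_timeShift {c : ℝ} {S : Conf (X × ℝ)} {p : X × ℝ} :
    p ∈ (timeShift c S).1 ↔ (p.1, p.2 + c) ∈ S.1 := Iff.rfl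

lemma timeShift_inter_eq_empty_iff {c : ℝ} {S : Conf (X × ℝ)} {A : Set (X × ℝ)} :
    (timeShift c S).1 ∩ A = ∅ ↔ S.1 ∩ (fun p => (p.1, p.2 + -c)) ⁻¹' A = ∅ := by
  simp only [Set.eq_empty_iff_forall_notMem, Set.mem_inter_iff, mem_timeShift, Set.mem_preimage,
    Prod.forall]
  exact forall_congr' fun x =>
    ⟨fun h r => by simpa using h (r + -c), fun h r => by simpa using h (r + c)⟩

/-- The points of `S` up to time `s`, followed by those of `S'` after time `0`, delayed by `s`. -/
def concat (s : ℝ) (S S' : Conf (X × ℝ)) : Conf (X × ℝ) :=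
  ⟨{p | (p.2 ≤ s ∧ p ∈ S.1) ∨ (s < p.2 ∧ p ∈ (timeShift (-s) S').1)}, fun K hK => by
    refine ((S.finite_inter hK).union ((timeShift (-s) S').finite_inter hK)).subset ?_
    rintro p ⟨hp | hp, hpK⟩
    · exact Or.inl ⟨hp.2, hpK⟩
    · exact Or.inr ⟨hp.2, hpK⟩⟩

lemma mem_concat {s : ℝ} {S S' : Conf (X × ℝ)} {p : X × ℝ} :
    p ∈ (concat s S S').1 ↔ (p.2 ≤ s ∧ p ∈ S.1) ∨ (s < p.2 ∧ (p.1, p.2 - s) ∈ S'.1) := Iff.rfl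

lemma concat_inter_eq_empty_iff {s : ℝ} {S S' : Conf (X × ℝ)} {A : Set (X × ℝ)} :
    (concat s S S').1 ∩ A = ∅ ↔ S.1 ∩ (A ∩ Prod.snd ⁻¹' Set.Iic s) = ∅ ∧
      (timeShift (-s) S').1 ∩ (A \ Prod.snd ⁻¹' Set.Iic s) = ∅ := by
  simp only [Set.eq_empty_iff_forall_notMem, ← forall_and]
  refine forall_congr' fun p => ?_
  simp only [concat, Set.mem_inter_iff, Set.mem_ofPred_eq, Set.mem_preimage, Set.mem_Iic,
    Set.mem_sdiff, not_le]
  tauto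

variable [MeasurableSpace X] [BorelSpace X] [SecondCountableTopology X]

lemma measurable_timeShift (c : ℝ) :
    Measurable (timeShift c : Conf (X × ℝ) → Conf (X × ℝ)) := by
  refine Conf.measurable_of_void fun A hA _ => ?_
  simp only [timeShift_inter_eq_empty_iff]
  exact Conf.measurableSet_void ((isometry_add_time (-c)).continuous.measurable hA)

lemma measurable_concat (s : ℝ) :
    Measurable fun q : Conf (X × ℝ) × Conf (X × ℝ) => concat s q.1 q.2 := by
  refine Conf.measurable_of_void fun A hA _ => ?_
  have hs : MeasurableSet (Prod.snd ⁻¹' Set.Iic s : Set (X × ℝ)) :=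
    measurable_snd measurableSet_Iic
  simp only [concat_inter_eq_empty_iff]
  exact (measurable_fst (Conf.measurableSet_void (hA.inter hs))).inter
    (((measurable_timeShift (-s)).comp measurable_snd) (Conf.measurableSet_void (hA.diff hs)))

end SpaceTime

/-! ### Poisson processes -/

section Poisson

variable {X Ω : Type*} [MetricSpace X] [MeasureSpace X] [MeasurableSpace Ω]

/-- The avoidance probabilities of a Poisson process of rate `lam`. They determine its law, and are
easier to verify for transforms of `S` than the definition of a Poisson process. -/
structure HasPoissonVoids (lam : ℝ) (S : Ω → Conf X) (P : Measure Ω) : Prop where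
  measurable : Measurable S
  void_prob : ∀ A : Set X, MeasurableSet A → IsBounded A →
    P.real {ω | (S ω).1 ∩ A = ∅} = Real.exp (-(lam * volume.real A))

section General

variable {P : Measure Ω} {lam : ℝ} {S : Ω → Conf X}

lemma IsPoissonProcess.measurable_ncard (hS : IsPoissonProcess lam S P) {A : Set X}
    (hA : MeasurableSet A) : Measurable fun ω => ((S ω).1 ∩ A).ncard :=
  (measurable_of_countable ENat.toNat).comp ((Conf.measurable_encard hA).comp hS.measurable)

lemma IsPoissonProcess.measureReal_ncard_eq (hS : IsPoissonProcess lam S P) (hlam : 0 ≤ lam)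
    {A : Set X} (hA : MeasurableSet A) (hA' : IsBounded A) (n : ℕ) :
    P.real {ω | ((S ω).1 ∩ A).ncard = n} =
      Real.exp (-(lam * volume.real A)) * (lam * volume.real A) ^ n / n.factorial := by
  have h_law := congrArg (Measure.real · {n}) (hS.law_count A hA hA')
  simp only [map_measureReal_apply (hS.measurable_ncard hA) (measurableSet_singleton n),
    poissonMeasure_real_singleton, NNReal.coe_mul, Real.coe_toNNReal _ hlam] at h_law
  exact h_law

lemma IsPoissonProcess.hasPoissonVoids (hS : IsPoissonProcess lam S P) (hlam : 0 ≤ lam) :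
    HasPoissonVoids lam S P where
  measurable := hS.measurable
  void_prob A hA hA' := by
    simpa [Set.ncard_eq_zero ((S _).finite_inter hA')] using
      hS.measureReal_ncard_eq hlam hA hA' 0

variable [IsProbabilityMeasure P]

lemma HasPoissonVoids.map_eq [BorelSpace X] [SecondCountableTopology X] {Ω' : Type*}
    [MeasurableSpace Ω'] {Q : Measure Ω'} [IsProbabilityMeasure Q] {S' : Ω' → Conf X}
    (hS : HasPoissonVoids lam S P) (hS' : HasPoissonVoids lam S' Q) : P.map S = Q.map S' := by
  have := Measure.isProbabilityMeasure_map (μ := P) hS.measurable.aemeasurable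
  have := Measure.isProbabilityMeasure_map (μ := Q) hS'.measurable.aemeasurable
  refine Conf.measure_ext fun A hA hA' => ?_
  rw [map_measureReal_apply hS.measurable (Conf.measurableSet_void hA),
    map_measureReal_apply hS'.measurable (Conf.measurableSet_void hA)]
  exact (hS.void_prob A hA hA').trans (hS'.void_prob A hA hA').symm

lemma HasPoissonVoids.ae_forall_notMem [OpensMeasurableSpace X] (hS : HasPoissonVoids lam S P)
    {N : Set X} (hN : MeasurableSet N) (hN₀ : volume N = 0) : ∀ᵐ ω ∂P, ∀ x ∈ (S ω).1, x ∉ N := by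
  obtain hX | ⟨⟨x₀⟩⟩ := isEmpty_or_nonempty X
  · simp
  have h_ball (n : ℕ) : ∀ᵐ ω ∂P, (S ω).1 ∩ (N ∩ Metric.closedBall x₀ n) = ∅ := by
    have hA : MeasurableSet (N ∩ Metric.closedBall x₀ n) := hN.inter measurableSet_closedBall
    have h_void := hS.void_prob _ hA (Metric.isBounded_closedBall.subset Set.inter_subset_right)
    rw [measureReal_def, measureReal_def, measure_mono_null Set.inter_subset_left hN₀,
      ENNReal.toReal_zero, mul_zero, neg_zero, Real.exp_zero, ENNReal.toReal_eq_one_iff] at h_void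
    exact (prob_compl_eq_zero_iff (hS.measurable (Conf.measurableSet_void hA))).2 h_void
  filter_upwards [ae_all_iff.2 h_ball] with ω hω x hx hxN
  obtain ⟨n, hn⟩ := exists_nat_ge (dist x x₀)
  exact Set.eq_empty_iff_forall_notMem.1 (hω n) x ⟨hx, hxN, hn⟩

end General

section SpaceTime

variable [BorelSpace X] [SecondCountableTopology X] [IsLocallyFiniteMeasure (volume : Measure X)]
  {P : Measure Ω} {lam : ℝ} {S : Ω → Conf (X × ℝ)}

lemma HasPoissonVoids.timeShift (hS : HasPoissonVoids lam S P) (c : ℝ) :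
    HasPoissonVoids lam (fun ω => timeShift c (S ω)) P where
  measurable := (measurable_timeShift c).comp hS.measurable
  void_prob A hA hA' := by
    have h_preserving : MeasurePreserving (fun p : X × ℝ => (p.1, p.2 + -c)) volume volume :=
      (MeasurePreserving.id _).prod (measurePreserving_add_right _ (-c))
    simp only [timeShift_inter_eq_empty_iff]
    rw [hS.void_prob _ (h_preserving.measurable hA)
      ((isometry_add_time (-c)).antilipschitz.isBounded_preimage hA'),
      h_preserving.measureReal_preimage hA.nullMeasurableSet]

lemma HasPoissonVoids.concat [ProperSpace X] [SFinite P] (hS : HasPoissonVoids lam S P) (s : ℝ) :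
    HasPoissonVoids lam (fun q : Ω × Ω => concat s (S q.1) (S q.2)) (P.prod P) where
  measurable := (measurable_concat s).comp ((hS.measurable.comp measurable_fst).prodMk
    (hS.measurable.comp measurable_snd))
  void_prob A hA hA' := by
    have hs : MeasurableSet (Prod.snd ⁻¹' Set.Iic s : Set (X × ℝ)) :=
      measurable_snd measurableSet_Iic
    have h_rect : {q : Ω × Ω | (PoissonTree.concat s (S q.1) (S q.2)).1 ∩ A = ∅} =
        {ω | (S ω).1 ∩ (A ∩ Prod.snd ⁻¹' Set.Iic s) = ∅} ×ˢ
          {ω | (PoissonTree.timeShift (-s) (S ω)).1 ∩ (A \ Prod.snd ⁻¹' Set.Iic s) = ∅} :=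
      Set.ext fun q => concat_inter_eq_empty_iff
    have : IsLocallyFiniteMeasure (volume : Measure (X × ℝ)) :=
      inferInstanceAs (IsLocallyFiniteMeasure (Measure.prod volume volume))
    rw [h_rect, measureReal_prod_prod,
      hS.void_prob _ (hA.inter hs) (hA'.subset Set.inter_subset_left),
      (hS.timeShift (-s)).void_prob _ (hA.diff hs) (hA'.subset Set.sdiff_subset), ← Real.exp_add,
      ← measureReal_inter_add_sdiff (s := A) hs hA'.measure_lt_top.ne, mul_add, neg_add]

end SpaceTime

end Poisson

/-! ### Walks -/

section Walks

variable {d : ℕ}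

/-- An obstacle of `S` meets the ray `{y} × (a, b]`, so that a walk sitting at `y` at time `a` has
moved by time `b`. -/
def Covered (S : Set (Space d × ℝ)) (y : Space d) (a b : ℝ) : Prop :=
  ∃ s ∈ S, a < s.2 ∧ s.2 ≤ b ∧ dist y s.1 ≤ 1

lemma Covered.mono_left {S : Set (Space d × ℝ)} {y : Space d} {a a' b : ℝ} (h : Covered S y a b)
    (ha : a' ≤ a) : Covered S y a' b :=
  let ⟨s, hs, has, hsb, hys⟩ := h
  ⟨s, hs, ha.trans_lt has, hsb, hys⟩

lemma not_covered_self (S : Set (Space d × ℝ)) (y : Space d) (a : ℝ) : ¬ Covered S y a a :=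
  fun ⟨_, _, has, hsa, _⟩ => has.not_ge hsa

lemma forall_hitTimes_lt_iff (S : Set (Space d × ℝ)) (s : Space d × ℝ) (t : ℝ) :
    (∀ u ∈ hitTimes S s, t < u) ↔ ¬ Covered S s.1 s.2 t := by
  constructor
  · rintro h ⟨s', hs', hlt, hle, hdist⟩
    exact (h s'.2 ⟨hlt, s'.1, hs', hdist⟩).not_ge hle
  · rintro h u ⟨hlt, x', hx', hdist⟩
    exact not_le.1 fun hu => h ⟨(x', u), hx', hlt, hu, hdist⟩

lemma mother_eq_self_or (S : Set (Space d × ℝ)) (s : Space d × ℝ) :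
    mother S s = s ∨ IsMother S s (mother S s) := by
  by_cases h : ∃ s', IsMother S s s'
  · exact Or.inr (by rw [mother, dif_pos h]; exact h.choose_spec)
  · exact Or.inl (dif_neg h)

lemma iterate_mother_eq_self_or (S : Set (Space d × ℝ)) (s : Space d × ℝ) (n : ℕ) :
    (mother S)^[n] s = s ∨ ((mother S)^[n] s ∈ S ∧ s.2 ≤ ((mother S)^[n] s).2) := by
  induction n with
  | zero => exact Or.inl rfl
  | succ n ih =>
    rw [Function.iterate_succ_apply']
    obtain h | ⟨h_mem, -, h_least⟩ := mother_eq_self_or S ((mother S)^[n] s)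
    · rwa [h]
    · have h_le : s.2 ≤ ((mother S)^[n] s).2 := ih.elim (fun h => by rw [h]) And.right
      exact Or.inr ⟨h_mem, h_le.trans h_least.1.1.le⟩

lemma walkAt_of_not_covered {S : Set (Space d × ℝ)} {s : Space d × ℝ} {t : ℝ} (hst : s.2 ≤ t)
    (h : ¬ Covered S s.1 s.2 t) : WalkAt S s t s.1 :=
  ⟨0, rfl, hst, (forall_hitTimes_lt_iff S s t).2 h⟩

lemma WalkAt.eq_or_exists {S : Set (Space d × ℝ)} {s : Space d × ℝ} {t : ℝ} {y : Space d}
    (h : WalkAt S s t y) : (y = s.1 ∧ s.2 ≤ t ∧ ¬ Covered S y s.2 t) ∨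
      ∃ r, (y, r) ∈ S ∧ s.2 ≤ r ∧ r ≤ t ∧ ¬ Covered S y r t := by
  obtain ⟨n, rfl, hnt, hn⟩ := h
  rw [forall_hitTimes_lt_iff] at hn
  obtain h | ⟨h_mem, h_le⟩ := iterate_mother_eq_self_or S s n
  · rw [h] at hnt hn ⊢
    exact Or.inl ⟨rfl, hnt, hn⟩
  · exact Or.inr ⟨_, h_mem, h_le, hnt, hn⟩

-- Coalescence: a jump lands on a point of `S`, and the walk then merges with the one started there.
lemma mem_processFrom (S : Set (Space d × ℝ)) (η : Set (Space d)) {t' t : ℝ} (htt : t' ≤ t)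
    {y : Space d} : y ∈ processFrom S η t' t ↔ (y ∈ η ∧ ¬ Covered S y t' t) ∨
      ∃ r, (y, r) ∈ S ∧ t' ≤ r ∧ r ≤ t ∧ ¬ Covered S y r t := by
  constructor
  · rintro ⟨s, hs, hw⟩
    have hts : t' ≤ s.2 := hs.elim (fun h => h.2.1) fun h => h.2.ge
    obtain ⟨rfl, hst, hc⟩ | ⟨r, hr, hsr, hrt, hc⟩ := hw.eq_or_exists
    · obtain ⟨hsS, -⟩ | ⟨hsη, rfl⟩ := hs
      · exact Or.inr ⟨s.2, hsS, hts, hst, hc⟩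
      · exact Or.inl ⟨hsη, hc⟩
    · exact Or.inr ⟨r, hr, hts.trans hsr, hrt, hc⟩
  · rintro (⟨hy, hc⟩ | ⟨r, hr, htr, hrt, hc⟩)
    · exact ⟨(y, t'), Or.inr ⟨hy, rfl⟩, walkAt_of_not_covered (s := (y, t')) htt hc⟩
    · exact ⟨(y, r), Or.inl ⟨hr, htr, hrt⟩, walkAt_of_not_covered (s := (y, r)) hrt hc⟩

lemma mem_processAt (S : Set (Space d × ℝ)) (t : ℝ) {y : Space d} :
    y ∈ processAt S t ↔ ∃ r, (y, r) ∈ S ∧ r ≤ t ∧ ¬ Covered S y r t := by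
  constructor
  · rintro ⟨s, hs, hst, hw⟩
    obtain ⟨rfl, -, hc⟩ | ⟨r, hr, -, hrt, hc⟩ := hw.eq_or_exists
    · exact ⟨s.2, hs, hst, hc⟩
    · exact ⟨r, hr, hrt, hc⟩
  · rintro ⟨r, hr, hrt, hc⟩
    exact ⟨(y, r), hr, hrt, walkAt_of_not_covered (s := (y, r)) hrt hc⟩

lemma processFrom_locallyFinite (S : Conf (Space d × ℝ)) (η : Conf (Space d)) {t' t : ℝ}
    (htt : t' ≤ t) (K : Set (Space d)) (hK : IsBounded K) :
    (processFrom S.1 η.1 t' t ∩ K).Finite := by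
  have hK' : IsBounded (K ×ˢ Set.Icc t' t) := hK.prod (Metric.isBounded_Icc _ _)
  refine ((η.finite_inter hK).union ((S.finite_inter hK').image Prod.fst)).subset ?_
  rintro y ⟨hy, hyK⟩
  obtain ⟨hyη, -⟩ | ⟨r, hr, htr, hrt, -⟩ := (mem_processFrom S.1 η.1 htt).1 hy
  · exact Or.inl ⟨hyη, hyK⟩
  · exact Or.inr ⟨(y, r), ⟨hr, hyK, htr, hrt⟩, rfl⟩

/-- The configuration `η^{η,0}_t` of the process started from `η` at time `0`. -/
noncomputable def evolve (t : ℝ) (S : Conf (Space d × ℝ)) (η : Conf (Space d)) : Conf (Space d) :=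
  Conf.ofSet (processFrom S.1 η.1 0 t)

lemma mem_evolve {t : ℝ} (ht : 0 ≤ t) {S : Conf (Space d × ℝ)} {η : Conf (Space d)} {y : Space d} :
    y ∈ (evolve t S η).1 ↔ (y ∈ η.1 ∧ ¬ Covered S.1 y 0 t) ∨
      ∃ r, (y, r) ∈ S.1 ∧ 0 ≤ r ∧ r ≤ t ∧ ¬ Covered S.1 y r t := by
  rw [evolve, Conf.ofSet_val (processFrom_locallyFinite S η ht), mem_processFrom S.1 η.1 ht]

lemma mem_evolve_iff_mem_processAt {t : ℝ} (ht : 0 ≤ t) {S : Conf (Space d × ℝ)}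
    {η : Conf (Space d)} {y : Space d} (hy : Covered S.1 y 0 t) :
    y ∈ (evolve t S η).1 ↔ y ∈ processAt S.1 t := by
  rw [mem_evolve ht, mem_processAt]
  constructor
  · rintro (⟨-, hc⟩ | ⟨r, hr, -, hrt, hc⟩)
    · exact absurd hy hc
    · exact ⟨r, hr, hrt, hc⟩
  · rintro ⟨r, hr, hrt, hc⟩
    exact Or.inr ⟨r, hr, le_of_not_ge fun hr0 => hc (hy.mono_left hr0), hrt, hc⟩

lemma covered_timeShift {c : ℝ} {S : Conf (Space d × ℝ)} {y : Space d} {a b : ℝ} :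
    Covered (timeShift c S).1 y a b ↔ Covered S.1 y (a + c) (b + c) := by
  simp only [Covered, mem_timeShift, Prod.exists]
  refine exists_congr fun x => ⟨?_, ?_⟩
  · rintro ⟨r, hr, har, hrb, hyx⟩
    exact ⟨r + c, hr, by linarith, by linarith, hyx⟩
  · rintro ⟨r, hr, har, hrb, hyx⟩
    exact ⟨r - c, by rwa [sub_add_cancel], by linarith, by linarith, hyx⟩

lemma processAt_timeShift (c t : ℝ) (S : Conf (Space d × ℝ)) :
    processAt (timeShift c S).1 t = processAt S.1 (t + c) := by
  ext y
  simp only [mem_processAt, covered_timeShift, mem_timeShift]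
  constructor
  · rintro ⟨r, hr, hrt, hc⟩
    exact ⟨r + c, hr, by linarith, hc⟩
  · rintro ⟨r, hr, hrt, hc⟩
    exact ⟨r - c, by rwa [sub_add_cancel], by linarith, by rwa [sub_add_cancel]⟩

lemma covered_concat_of_le {s : ℝ} {S S' : Conf (Space d × ℝ)} {y : Space d} {a b : ℝ}
    (ha : s ≤ a) : Covered (concat s S S').1 y a b ↔ Covered S'.1 y (a - s) (b - s) := by
  simp only [Covered, mem_concat, Prod.exists]
  refine exists_congr fun x => ⟨?_, ?_⟩
  · rintro ⟨r, ⟨hrs, -⟩ | ⟨-, hr⟩, har, hrb, hyx⟩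
    · exact absurd (ha.trans_lt har) hrs.not_gt
    · exact ⟨r - s, hr, by linarith, by linarith, hyx⟩
  · rintro ⟨r, hr, har, hrb, hyx⟩
    exact ⟨r + s, Or.inr ⟨by linarith, by rwa [add_sub_cancel_right]⟩, by linarith, by linarith,
      hyx⟩

lemma covered_concat {s : ℝ} {S S' : Conf (Space d × ℝ)} {y : Space d} {a b : ℝ}
    (ha : a ≤ s) (hb : s ≤ b) : Covered (concat s S S').1 y a b ↔
      Covered S.1 y a s ∨ Covered S'.1 y 0 (b - s) := by
  rw [← sub_self s, ← covered_concat_of_le (S := S) le_rfl]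
  constructor
  · rintro ⟨p, hp, hap, hpb, hyp⟩
    obtain hps | hps := le_or_gt p.2 s
    · exact Or.inl ⟨p, (mem_concat.1 hp).elim And.right fun h => absurd h.1 hps.not_gt, hap, hps,
        hyp⟩
    · exact Or.inr ⟨p, hp, hps, hpb, hyp⟩
  · rintro (⟨p, hp, hap, hps, hyp⟩ | h)
    · exact ⟨p, mem_concat.2 (Or.inl ⟨hps, hp⟩), hap, hps.trans hb, hyp⟩
    · exact h.mono_left ha

lemma evolve_zero {S : Conf (Space d × ℝ)} (hS : ∀ p ∈ S.1, p.2 ≠ 0) (η : Conf (Space d)) :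
    evolve 0 S η = η := by
  refine Subtype.ext (Set.ext fun y => (mem_evolve le_rfl).trans ⟨?_, fun hy => ?_⟩)
  · rintro (⟨hy, -⟩ | ⟨r, hr, hr0, hr0', -⟩)
    · exact hy
    · exact absurd (hr0'.antisymm hr0) (hS _ hr)
  · exact Or.inl ⟨hy, not_covered_self _ _ _⟩

lemma evolve_concat {s t : ℝ} (hs : 0 ≤ s) (ht : 0 ≤ t) (S : Conf (Space d × ℝ))
    {S' : Conf (Space d × ℝ)} (hS' : ∀ p ∈ S'.1, p.2 ≠ 0) (η : Conf (Space d)) :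
    evolve (s + t) (concat s S S') η = evolve t S' (evolve s S η) := by
  have hst : s ≤ s + t := le_add_of_nonneg_right ht
  have h_before {a : ℝ} {y : Space d} (ha : a ≤ s) : ¬ Covered (concat s S S').1 y a (s + t) ↔
      ¬ Covered S.1 y a s ∧ ¬ Covered S'.1 y 0 t := by
    rw [covered_concat ha hst, add_sub_cancel_left, not_or]
  have h_after {a : ℝ} {y : Space d} (ha : s ≤ a) : Covered (concat s S S').1 y a (s + t) ↔
      Covered S'.1 y (a - s) t := by
    rw [covered_concat_of_le ha, add_sub_cancel_left]
  refine Subtype.ext (Set.ext fun y => ?_)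
  rw [mem_evolve (hs.trans hst), mem_evolve ht, mem_evolve hs, h_before hs]
  constructor
  · rintro (⟨hy, hc, hc'⟩ | ⟨r, ⟨hrs, hr⟩ | ⟨hsr, hr⟩, hr0, hrt, hc⟩)
    · exact Or.inl ⟨Or.inl ⟨hy, hc⟩, hc'⟩
    · have hc := (h_before hrs).1 hc
      exact Or.inl ⟨Or.inr ⟨r, hr, hr0, hrs, hc.1⟩, hc.2⟩
    · exact Or.inr ⟨r - s, hr, sub_nonneg.2 hsr.le, sub_le_iff_le_add'.2 hrt,
        fun h => hc ((h_after hsr.le).2 h)⟩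
  · rintro (⟨⟨hy, hc⟩ | ⟨r, hr, hr0, hrs, hc⟩, hc'⟩ | ⟨r, hr, hr0, hrt, hc⟩)
    · exact Or.inl ⟨hy, hc, hc'⟩
    · exact Or.inr ⟨r, Or.inl ⟨hrs, hr⟩, hr0, hrs.trans hst, (h_before hrs).2 ⟨hc, hc'⟩⟩
    · have hr_pos : 0 < r := hr0.lt_of_ne' (hS' _ hr)
      refine Or.inr ⟨r + s, mem_concat.2 (Or.inr ⟨lt_add_of_pos_left s hr_pos, ?_⟩),
        add_nonneg hr0 hs, by linarith, ?_⟩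
      · rwa [add_sub_cancel_right]
      · rwa [h_after (le_add_of_nonneg_left hr0), add_sub_cancel_right]

end Walks

/-! ### Measurability of the process -/

section Measurability

variable {d : ℕ} {α : Type*} [MeasurableSpace α]

lemma measurableSet_covered {g : α → Conf (Space d × ℝ)} (hg : Measurable g) {y : α → Space d}
    (hy : Measurable y) {a b : α → ℝ} (ha : Measurable a) (hb : Measurable b) :
    MeasurableSet {x | Covered (g x).1 (y x) (a x) (b x)} := by
  have hD : MeasurableSet {q : α × (Space d × ℝ) |
      a q.1 < q.2.2 ∧ q.2.2 ≤ b q.1 ∧ dist (y q.1) q.2.1 ≤ 1} := by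
    measurability
  convert (Conf.measurableSet_void_section hg hD).compl using 1
  ext x
  simp [Covered]

lemma measurableSet_forall_covered {D : Set (Space d × ℝ)} (hD : MeasurableSet D) (t : ℝ) :
    MeasurableSet {S : Conf (Space d × ℝ) | ∀ p ∈ S.1, p ∈ D → Covered S.1 p.1 p.2 t} := by
  have h_covered : MeasurableSet {q : Conf (Space d × ℝ) × (Space d × ℝ) |
      Covered q.1.1 q.2.1 q.2.2 t} :=
    measurableSet_covered measurable_fst (measurable_fst.comp measurable_snd)
      (measurable_snd.comp measurable_snd) measurable_const
  convert Conf.measurableSet_void_section measurable_id ((measurable_snd hD).diff h_covered)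
    using 1
  ext S
  simp

lemma measurable_evolve {t : ℝ} (ht : 0 ≤ t) :
    Measurable fun q : Conf (Space d × ℝ) × Conf (Space d) => evolve t q.1 q.2 := by
  refine Conf.measurable_of_void fun A hA _ => ?_
  have h_covered : MeasurableSet {q : (Conf (Space d × ℝ) × Conf (Space d)) × Space d |
      Covered q.1.1.1 q.2 0 t} :=
    measurableSet_covered (measurable_fst.comp measurable_fst) measurable_snd measurable_const
      measurable_const
  have h_S := measurableSet_forall_covered (hA.prod (measurableSet_Icc (a := 0) (b := t))) t
  convert (Conf.measurableSet_void_section measurable_snd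
    ((measurable_snd hA).diff h_covered)).inter (measurable_fst h_S)
    using 1
  ext ⟨S, η⟩
  simp only [Set.eq_empty_iff_forall_notMem, Set.mem_inter_iff, Set.mem_ofPred_eq, mem_evolve ht,
    Set.mem_sdiff, Set.mem_preimage, Set.mem_prod, Set.mem_Icc, Prod.forall]
  grind

lemma measurable_update (η : Conf (Space d)) : Measurable (update η) := by
  refine Conf.measurable_of_void fun A hA _ => ?_
  have hD : MeasurableSet {x : Space d × Space d | x.2 ∈ A ∧ x.2 ∉ Metric.closedBall x.1 1} :=
    (measurable_snd hA).inter
      (measurableSet_le (measurable_snd.dist measurable_fst) measurable_const).compl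
  convert hA.compl.inter (Conf.measurableSet_void_section (g := fun _ : Space d => η)
    measurable_const hD) using 1
  ext u
  simp only [Set.eq_empty_iff_forall_notMem, Set.mem_inter_iff, Set.mem_ofPred_eq, update,
    Set.mem_union, Set.mem_sdiff, Set.mem_singleton_iff, Set.mem_compl_iff]
  grind

-- Of two points of `S` above each other, the later one covers the earlier one.
lemma injOn_fst_not_covered (S : Set (Space d × ℝ)) (t : ℝ) :
    {p ∈ S | p.2 ≤ t ∧ ¬ Covered S p.1 p.2 t}.InjOn Prod.fst := by
  have h_le {p q : Space d × ℝ} (hp : ¬ Covered S p.1 p.2 t) (hq : q ∈ S) (hqt : q.2 ≤ t)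
      (hpq : p.1 = q.1) : q.2 ≤ p.2 :=
    not_lt.1 fun hlt => hp ⟨q, hq, hlt, hqt, by simp [hpq]⟩
  rintro p ⟨hp, hpt, hpc⟩ q ⟨hq, hqt, hqc⟩ hpq
  exact Prod.ext hpq ((h_le hqc hp hpt hpq.symm).antisymm (h_le hpc hq hqt hpq))

lemma processAt_locallyFinite_iff (S : Conf (Space d × ℝ)) (t : ℝ) :
    (∀ K : Set (Space d), IsBounded K → (processAt S.1 t ∩ K).Finite) ↔
      ∀ n : ℕ, ∃ m : ℕ, ∀ p ∈ S.1, p.1 ∈ Metric.closedBall 0 n → p.2 < t - m →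
        Covered S.1 p.1 p.2 t := by
  constructor
  · intro h n
    let A := {p ∈ S.1 | p.1 ∈ Metric.closedBall 0 n ∧ p.2 ≤ t ∧ ¬ Covered S.1 p.1 p.2 t}
    have hA_inj : A.InjOn Prod.fst := by
      refine (injOn_fst_not_covered S.1 t).mono ?_
      exact fun p hp => ⟨hp.1, hp.2.2⟩
    have hA_fin : A.Finite := by
      refine Set.Finite.of_finite_image
        ((h (Metric.closedBall 0 n) Metric.isBounded_closedBall).subset ?_) hA_inj
      rintro _ ⟨p, ⟨hp, hpn, hpt, hc⟩, rfl⟩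
      exact ⟨(mem_processAt S.1 t).2 ⟨p.2, hp, hpt, hc⟩, hpn⟩
    obtain ⟨T, hT⟩ := (hA_fin.image Prod.snd).bddBelow
    obtain ⟨m, hm⟩ := exists_nat_ge (t - T)
    refine ⟨m, fun p hp hpn hpm => by_contra fun hc => ?_⟩
    have hmt : t - m ≤ t := sub_le_self t m.cast_nonneg
    have hTp : T ≤ p.2 := hT ⟨p, ⟨hp, hpn, hpm.le.trans hmt, hc⟩, rfl⟩
    linarith
  · intro h K hK
    obtain ⟨R, hR⟩ := hK.subset_closedBall 0
    obtain ⟨n, hn⟩ := exists_nat_ge R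
    obtain ⟨m, hm⟩ := h n
    have hK' : IsBounded (K ×ˢ Set.Icc (t - m) t) := hK.prod (Metric.isBounded_Icc _ _)
    refine ((S.finite_inter hK').image Prod.fst).subset ?_
    rintro y ⟨hy, hyK⟩
    obtain ⟨r, hr, hrt, hc⟩ := (mem_processAt S.1 t).1 hy
    have hmr : t - m ≤ r := not_lt.1 fun hrm =>
      hc (hm _ hr (Metric.closedBall_subset_closedBall hn (hR hyK)) hrm)
    exact ⟨(y, r), ⟨hr, hyK, hmr, hrt⟩, rfl⟩

/-- The configuration `η_t` of the process started in the infinite past, at time `t`. It is empty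
in the exceptional case that infinitely many walks are in a bounded region at time `t`. -/
noncomputable def pastProcess (t : ℝ) (S : Conf (Space d × ℝ)) : Conf (Space d) :=
  Conf.ofSet (processAt S.1 t)

lemma measurable_pastProcess (t : ℝ) :
    Measurable (pastProcess t : Conf (Space d × ℝ) → Conf (Space d)) := by
  refine Conf.measurable_of_void fun A hA _ => ?_
  have h_finite : MeasurableSet {S : Conf (Space d × ℝ) |
      ∀ K : Set (Space d), IsBounded K → (processAt S.1 t ∩ K).Finite} := by
    simp only [processAt_locallyFinite_iff, Set.ofPred_forall (ι := ℕ), Set.ofPred_exists]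
    refine .iInter fun n => .iUnion fun m => ?_
    have hD : MeasurableSet (Metric.closedBall (0 : Space d) n ×ˢ Set.Iio (t - m)) :=
      measurableSet_closedBall.prod measurableSet_Iio
    simpa only [Set.mem_prod, Set.mem_Iio, and_imp] using measurableSet_forall_covered hD t
  have h_past := measurableSet_forall_covered (hA.prod (measurableSet_Iic (a := t))) t
  convert h_finite.compl.union h_past using 1
  ext S
  by_cases h : ∀ K : Set (Space d), IsBounded K → (processAt S.1 t ∩ K).Finite
  · simp only [pastProcess, Conf.ofSet_val h, Set.eq_empty_iff_forall_notMem, Set.mem_inter_iff,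
      mem_processAt, Set.mem_ofPred_eq, Set.mem_union, Set.mem_compl_iff, Set.mem_prod,
      Set.mem_Iic, Prod.forall, eq_true h, not_true_eq_false, false_or]
    grind
  · simp [pastProcess, Conf.ofSet, h]

end Measurability

/-! ### Covering probabilities -/

section Coverage

variable {d : ℕ}

/-- The volume of a ball of radius `1/2` in `ℝ^(d-1)`: two points of such a ball are at distance at
most one, so it is cleared by any obstacle centred in it. This is the rate of convergence `C_d`. -/
noncomputable def halfBallVolume (d : ℕ) : ℝ :=
  volume.real (Metric.closedBall (0 : Space d) (1 / 2))

lemma halfBallVolume_pos (d : ℕ) : 0 < halfBallVolume d :=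
  ENNReal.toReal_pos (Metric.measure_closedBall_pos volume 0 one_half_pos).ne'
    measure_closedBall_lt_top.ne

lemma exists_finset_cover_closedBall {X : Type*} [PseudoMetricSpace X] [ProperSpace X] {K : Set X}
    (hK : IsBounded K) {r : ℝ} (hr : 0 < r) :
    ∃ F : Finset X, K ⊆ ⋃ x ∈ F, Metric.closedBall x r := by
  obtain ⟨F, -, hF, hKF⟩ := hK.isCompact_closure.finite_cover_balls hr
  refine ⟨hF.toFinset, subset_closure.trans (hKF.trans ?_)⟩
  simp only [Set.Finite.mem_toFinset]
  exact Set.iUnion₂_mono fun x _ => Metric.ball_subset_closedBall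

variable {Ω : Type*} [MeasurableSpace Ω] {P : Measure Ω} {lam : ℝ} {S : Ω → Conf (Space d × ℝ)}

lemma HasPoissonVoids.measureReal_halfBall_eq_empty (hS : HasPoissonVoids lam S P) (x : Space d)
    {a b : ℝ} (hab : a ≤ b) :
    P.real {ω | (S ω).1 ∩ (Metric.closedBall x (1 / 2) ×ˢ Set.Ioc a b) = ∅} =
      Real.exp (-(halfBallVolume d * lam * (b - a))) := by
  rw [hS.void_prob _ (measurableSet_closedBall.prod measurableSet_Ioc)
    (Metric.isBounded_closedBall.prod (Metric.isBounded_Ioc _ _)), Measure.volume_eq_prod,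
    measureReal_prod_prod, Real.volume_real_Ioc_of_le hab,
    Measure.addHaar_real_closedBall_center, halfBallVolume]
  ring_nf

lemma HasPoissonVoids.measureReal_not_covered_le [IsFiniteMeasure P] (hS : HasPoissonVoids lam S P)
    {K : Set (Space d)} {F : Finset (Space d)} (hK : K ⊆ ⋃ x ∈ F, Metric.closedBall x (1 / 2))
    {a b : ℝ} (hab : a ≤ b) :
    P.real {ω | ¬ ∀ y ∈ K, Covered (S ω).1 y a b} ≤
      F.card * Real.exp (-(halfBallVolume d * lam * (b - a))) := by
  have h_sub : {ω | ¬ ∀ y ∈ K, Covered (S ω).1 y a b} ⊆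
      ⋃ x ∈ F, {ω | (S ω).1 ∩ (Metric.closedBall x (1 / 2) ×ˢ Set.Ioc a b) = ∅} := by
    intro ω hω
    obtain ⟨y, hyK, hy⟩ : ∃ y ∈ K, ¬ Covered (S ω).1 y a b := by simpa using hω
    obtain ⟨x, hxF, hyx⟩ := Set.mem_iUnion₂.1 (hK hyK)
    refine Set.mem_iUnion₂.2 ⟨x, hxF, Set.eq_empty_iff_forall_notMem.2 ?_⟩
    rintro s ⟨hs, hsx, has, hsb⟩
    refine hy ⟨s, hs, has, hsb, ?_⟩
    linarith [dist_triangle_right y s.1 x, Metric.mem_closedBall.1 hyx, Metric.mem_closedBall.1 hsx]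
  calc P.real {ω | ¬ ∀ y ∈ K, Covered (S ω).1 y a b}
      ≤ ∑ x ∈ F, P.real {ω | (S ω).1 ∩ (Metric.closedBall x (1 / 2) ×ˢ Set.Ioc a b) = ∅} :=
        (measureReal_mono h_sub (measure_ne_top P _)).trans (measureReal_biUnion_finset_le _ _)
    _ = F.card * Real.exp (-(halfBallVolume d * lam * (b - a))) := by
        simp only [hS.measureReal_halfBall_eq_empty _ hab, Finset.sum_const, nsmul_eq_mul]

lemma tendsto_const_mul_exp_neg_mul_atTop (c : ℝ) {k : ℝ} (hk : 0 < k) :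
    Tendsto (fun t => c * Real.exp (-(k * t))) atTop (𝓝 0) := by
  simpa using (Real.tendsto_exp_neg_atTop_nhds_zero.comp
    (tendsto_id.const_mul_atTop hk)).const_mul c

lemma HasPoissonVoids.ae_processAt_locallyFinite [IsFiniteMeasure P] (hS : HasPoissonVoids lam S P)
    (hlam : 0 < lam) (t : ℝ) :
    ∀ᵐ ω ∂P, ∀ K : Set (Space d), IsBounded K → (processAt (S ω).1 t ∩ K).Finite := by
  have h_cov (n : ℕ) :
      ∀ᵐ ω ∂P, ∃ m : ℕ, ∀ y ∈ Metric.closedBall (0 : Space d) n, Covered (S ω).1 y (t - m) t := by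
    obtain ⟨F, hF⟩ := exists_finset_cover_closedBall
      (Metric.isBounded_closedBall (x := (0 : Space d)) (r := n)) one_half_pos
    have h_le (m : ℕ) : P.real {ω | ¬ ∃ m : ℕ, ∀ y ∈ Metric.closedBall (0 : Space d) n,
        Covered (S ω).1 y (t - m) t} ≤ F.card * Real.exp (-(halfBallVolume d * lam * m)) := by
      have h := hS.measureReal_not_covered_le hF (sub_le_self t m.cast_nonneg)
      rw [sub_sub_cancel] at h
      exact (measureReal_mono (fun ω (hω : ¬ ∃ m, _) hc => hω ⟨m, hc⟩) (measure_ne_top P _)).trans h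
    have h_lim := (tendsto_const_mul_exp_neg_mul_atTop F.card
      (mul_pos (halfBallVolume_pos d) hlam)).comp tendsto_natCast_atTop_atTop
    exact (measureReal_eq_zero_iff (measure_ne_top P _)).1
      (measureReal_nonneg.antisymm' (ge_of_tendsto' h_lim h_le))
  filter_upwards [ae_all_iff.2 h_cov] with ω hω
  refine (processAt_locallyFinite_iff (S ω) t).2 fun n => ?_
  obtain ⟨m, hm⟩ := hω n
  exact ⟨m, fun p _ hpn hpm => (hm p.1 hpn).mono_left hpm.le⟩

end Coverage

/-! ### The semigroup and its stationary state -/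

section Semigroup

lemma abs_integral_sub_le_of_eqOn_compl {α : Type*} [MeasurableSpace α] {μ : Measure α}
    [IsFiniteMeasure μ] {F G : α → ℝ} (hF : Integrable F μ) (hG : Integrable G μ) {c : ℝ}
    (hc : ∀ a, |F a - G a| ≤ c) {B : Set α} (hB : ∀ᵐ a ∂μ, a ∉ B → F a = G a) :
    |∫ a, F a ∂μ - ∫ a, G a ∂μ| ≤ c * μ.real B := by
  rw [← Real.norm_eq_abs, ← integral_sub hF hG,
    ← setIntegral_eq_integral_of_ae_compl_eq_zero (s := B)
    (hB.mono fun a ha haB => sub_eq_zero.2 (ha haB))]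
  exact norm_setIntegral_le_of_norm_le_const (measure_lt_top μ B) fun a _ => hc a

lemma abs_sub_le_two_mul {x y M : ℝ} (hx : |x| ≤ M) (hy : |y| ≤ M) : |x - y| ≤ 2 * M := by
  linarith [abs_sub x y]

variable {d : ℕ} {Ω : Type*} [MeasurableSpace Ω] {P : Measure Ω} {lam : ℝ}
  {S : Ω → Conf (Space d × ℝ)} {f : Conf (Space d) → ℝ}

lemma IsBoundedLocal.integrable_comp (hf : IsBoundedLocal f) {α : Type*} [MeasurableSpace α]
    {μ : Measure α} [IsFiniteMeasure μ] {g : α → Conf (Space d)} (hg : Measurable g) :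
    Integrable (fun a => f (g a)) μ :=
  let ⟨M, hM⟩ := hf.bounded
  .of_bound (hf.measurable.comp hg).aestronglyMeasurable M (.of_forall fun a => hM (g a))

lemma semigroup_eq_integral_evolve (t : ℝ) (f : Conf (Space d) → ℝ) (η : Conf (Space d)) :
    semigroup P S t f η = ∫ ω, f (evolve t (S ω) η) ∂P := rfl

lemma measurable_evolve_comp {t : ℝ} (ht : 0 ≤ t) (hS : Measurable S) (η : Conf (Space d)) :
    Measurable fun ω => evolve t (S ω) η :=
  (measurable_evolve ht).comp (hS.prodMk measurable_const)

lemma evolve_inter_congr {t : ℝ} (ht : 0 ≤ t) (S : Conf (Space d × ℝ)) {η ξ : Conf (Space d)}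
    {Λ : Set (Space d)} (h : η.1 ∩ Λ = ξ.1 ∩ Λ) :
    (evolve t S η).1 ∩ Λ = (evolve t S ξ).1 ∩ Λ := by
  have h_mem {y : Space d} (hy : y ∈ Λ) : y ∈ η.1 ↔ y ∈ ξ.1 := by
    simpa [hy] using Set.ext_iff.1 h y
  ext y
  simp only [Set.mem_inter_iff, mem_evolve ht]
  exact and_congr_left fun hy => or_congr_left (and_congr_left' (h_mem hy))

lemma IsBoundedLocal.semigroup [IsProbabilityMeasure P] (hf : IsBoundedLocal f) (hS : Measurable S)
    {t : ℝ} (ht : 0 ≤ t) : IsBoundedLocal (semigroup P S t f) where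
  measurable := by
    have h : Measurable fun q : Conf (Space d) × Ω => f (evolve t (S q.2) q.1) :=
      hf.measurable.comp
        ((measurable_evolve ht).comp ((hS.comp measurable_snd).prodMk measurable_fst))
    exact (h.stronglyMeasurable.integral_prod_right' (ν := P)).measurable
  bounded := by
    obtain ⟨M, hM⟩ := hf.bounded
    refine ⟨M, fun η => ?_⟩
    simpa [semigroup_eq_integral_evolve] using
      norm_integral_le_of_norm_le_const (μ := P) (f := fun ω => f (evolve t (S ω) η))
      (.of_forall fun ω => hM _)
  finite_support := by
    obtain ⟨Λ, hΛ, h⟩ := hf.finite_support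
    exact ⟨Λ, hΛ, fun η ξ hηξ =>
      integral_congr_ae (.of_forall fun ω => h _ _ (evolve_inter_congr ht (S ω) hηξ))⟩

variable [IsProbabilityMeasure P]

lemma HasPoissonVoids.ae_time_ne (hS : HasPoissonVoids lam S P) (c : ℝ) :
    ∀ᵐ ω ∂P, ∀ p ∈ (S ω).1, p.2 ≠ c := by
  refine hS.ae_forall_notMem (N := {p | p.2 = c}) (measurable_snd (measurableSet_singleton c)) ?_
  have h_prod : {p : Space d × ℝ | p.2 = c} = Set.univ ×ˢ {c} := by ext p; simp
  rw [h_prod, Measure.volume_eq_prod, Measure.prod_prod, Real.volume_singleton, mul_zero]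

lemma HasPoissonVoids.semigroup_zero (hS : HasPoissonVoids lam S P) (f : Conf (Space d) → ℝ) :
    semigroup P S 0 f = f := by
  funext η
  have h : (fun ω => f (evolve 0 (S ω) η)) =ᵐ[P] fun _ => f η :=
    (hS.ae_time_ne 0).mono fun ω hω => congrArg f (evolve_zero hω η)
  rw [semigroup_eq_integral_evolve, integral_congr_ae h]
  simp

lemma HasPoissonVoids.semigroup_add (hS : HasPoissonVoids lam S P) (hf : IsBoundedLocal f)
    {s t : ℝ} (hs : 0 ≤ s) (ht : 0 ≤ t) :
    semigroup P S (s + t) f = semigroup P S s (semigroup P S t f) := by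
  funext η
  have h_meas : AEStronglyMeasurable (fun S' => f (evolve (s + t) S' η)) (P.map S) :=
    (hf.measurable.comp
      (measurable_evolve_comp (add_nonneg hs ht) measurable_id η)).aestronglyMeasurable
  have h_concat := hS.concat s
  have h_time : ∀ᵐ q ∂(P.prod P), ∀ p ∈ (S q.2).1, p.2 ≠ 0 :=
    Measure.quasiMeasurePreserving_snd.ae (hS.ae_time_ne 0)
  have h_evolve : Measurable fun q : Ω × Ω => evolve t (S q.2) (evolve s (S q.1) η) :=
    (measurable_evolve ht).comp ((hS.measurable.comp measurable_snd).prodMk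
      ((measurable_evolve_comp hs hS.measurable η).comp measurable_fst))
  calc semigroup P S (s + t) f η
      = ∫ S', f (evolve (s + t) S' η) ∂(P.map S) :=
        (integral_map hS.measurable.aemeasurable h_meas).symm
    _ = ∫ q, f (evolve (s + t) (PoissonTree.concat s (S q.1) (S q.2)) η) ∂(P.prod P) := by
        rw [hS.map_eq h_concat] at h_meas ⊢
        exact integral_map h_concat.measurable.aemeasurable h_meas
    _ = ∫ q, f (evolve t (S q.2) (evolve s (S q.1) η)) ∂(P.prod P) :=
        integral_congr_ae (h_time.mono fun q hq =>
          congrArg f (evolve_concat hs ht (S q.1) hq η))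
    _ = ∫ ω, ∫ ω', f (evolve t (S ω') (evolve s (S ω) η)) ∂P ∂P :=
        integral_prod _ (hf.integrable_comp h_evolve)
    _ = semigroup P S s (semigroup P S t f) η := rfl

lemma HasPoissonVoids.stationaryState_eq_map (hS : HasPoissonVoids lam S P) (t : ℝ) :
    stationaryState P S = P.map fun ω => pastProcess t (S ω) := by
  calc stationaryState P S
      = (P.map S).map (pastProcess 0) :=
        (Measure.map_map (measurable_pastProcess 0) hS.measurable).symm
    _ = P.map fun ω => pastProcess 0 (PoissonTree.timeShift t (S ω)) := by
        rw [hS.map_eq (hS.timeShift t)]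
        exact Measure.map_map (measurable_pastProcess 0) (hS.timeShift t).measurable
    _ = P.map fun ω => pastProcess t (S ω) := by
        simp only [pastProcess, processAt_timeShift, zero_add]

lemma HasPoissonVoids.isProbabilityMeasure_stationaryState (hS : HasPoissonVoids lam S P) :
    IsProbabilityMeasure (stationaryState P S) :=
  Measure.isProbabilityMeasure_map ((measurable_pastProcess 0).comp hS.measurable).aemeasurable

lemma HasPoissonVoids.abs_semigroup_sub_le (hS : HasPoissonVoids lam S P) (hlam : 0 < lam)
    (hf : IsBoundedLocal f) {M : ℝ} (hM : ∀ η, |f η| ≤ M) {Λ : Set (Space d)}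
    (hΛ : ∀ η ξ : Conf (Space d), η.1 ∩ Λ = ξ.1 ∩ Λ → f η = f ξ) {F : Finset (Space d)}
    (hF : Λ ⊆ ⋃ x ∈ F, Metric.closedBall x (1 / 2)) {t : ℝ} (ht : 0 ≤ t) (η : Conf (Space d)) :
    |semigroup P S t f η - ∫ ξ, f ξ ∂(stationaryState P S)| ≤
      2 * M * F.card * Real.exp (-(halfBallVolume d * lam * t)) := by
  have h_past : Measurable fun ω => pastProcess t (S ω) :=
    (measurable_pastProcess t).comp hS.measurable
  have h_eq : ∀ᵐ ω ∂P, ω ∉ {ω | ¬ ∀ y ∈ Λ, Covered (S ω).1 y 0 t} →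
      f (evolve t (S ω) η) = f (pastProcess t (S ω)) := by
    filter_upwards [hS.ae_processAt_locallyFinite hlam t] with ω hω h_cov
    refine hΛ _ _ (Set.ext fun y => and_congr_left fun hy => ?_)
    rw [pastProcess, Conf.ofSet_val hω, mem_evolve_iff_mem_processAt ht (not_not.1 h_cov y hy)]
  have h_cov : P.real {ω | ¬ ∀ y ∈ Λ, Covered (S ω).1 y 0 t} ≤
      F.card * Real.exp (-(halfBallVolume d * lam * t)) := by
    simpa using hS.measureReal_not_covered_le hF ht
  have hM₀ : 0 ≤ M := (abs_nonneg (f η)).trans (hM η)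
  rw [hS.stationaryState_eq_map t,
    integral_map h_past.aemeasurable hf.measurable.aestronglyMeasurable]
  calc |semigroup P S t f η - ∫ ω, f (pastProcess t (S ω)) ∂P|
      ≤ 2 * M * P.real {ω | ¬ ∀ y ∈ Λ, Covered (S ω).1 y 0 t} :=
        abs_integral_sub_le_of_eqOn_compl
          (hf.integrable_comp (measurable_evolve_comp ht hS.measurable η))
          (hf.integrable_comp h_past) (fun ω => abs_sub_le_two_mul (hM _) (hM _)) h_eq
    _ ≤ 2 * M * F.card * Real.exp (-(halfBallVolume d * lam * t)) := by
        rw [mul_assoc (2 * M)]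
        gcongr

lemma IsBoundedLocal.exists_forall_abs_semigroup_sub_le (hf : IsBoundedLocal f) :
    ∃ C : ℝ, ∀ lam : ℝ, 0 < lam → ∀ (Ω : Type*) [MeasurableSpace Ω] (P : Measure Ω)
      [IsProbabilityMeasure P] (S : Ω → Conf (Space d × ℝ)), HasPoissonVoids lam S P →
        ∀ t : ℝ, 0 ≤ t → ∀ η : Conf (Space d),
          |PoissonTree.semigroup P S t f η - ∫ ξ, f ξ ∂(stationaryState P S)| ≤
            C * Real.exp (-(halfBallVolume d * lam * t)) := by
  obtain ⟨M, hM⟩ := hf.bounded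
  obtain ⟨Λ, hΛ, hfΛ⟩ := hf.finite_support
  obtain ⟨F, hF⟩ := exists_finset_cover_closedBall hΛ one_half_pos
  exact ⟨2 * M * F.card, fun lam hlam Ω _ P _ S hS t ht η =>
    hS.abs_semigroup_sub_le hlam hf hM hfΛ hF ht η⟩

lemma HasPoissonVoids.tendstoUniformly_semigroup (hS : HasPoissonVoids lam S P) (hlam : 0 < lam)
    (hf : IsBoundedLocal f) : TendstoUniformly (fun t => semigroup P S t f)
      (fun _ => ∫ ξ, f ξ ∂(stationaryState P S)) atTop := by
  obtain ⟨C, hC⟩ := hf.exists_forall_abs_semigroup_sub_le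
  have h_lim := tendsto_const_mul_exp_neg_mul_atTop C (mul_pos (halfBallVolume_pos d) hlam)
  rw [Metric.tendstoUniformly_iff]
  intro ε hε
  filter_upwards [h_lim.eventually (gt_mem_nhds hε), eventually_ge_atTop 0] with t h_lt ht η
  rw [dist_comm, Real.dist_eq]
  exact (hC lam hlam Ω P S hS t ht η).trans_lt h_lt

lemma tendsto_integral_of_tendstoUniformly_const {α ι : Type*} [MeasurableSpace α]
    {μ : Measure α} [IsProbabilityMeasure μ] {l : Filter ι} {F : ι → α → ℝ} {c : ℝ}
    (hF : ∀ᶠ i in l, Integrable (F i) μ) (h : TendstoUniformly F (fun _ => c) l) :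
    Tendsto (fun i => ∫ a, F i a ∂μ) l (𝓝 c) := by
  rw [Metric.tendsto_nhds]
  intro ε hε
  filter_upwards [Metric.tendstoUniformly_iff.1 h (ε / 2) (half_pos hε), hF] with i hi hFi
  have h_le (a : α) : |F i a - c| ≤ ε / 2 := by
    rw [← Real.dist_eq, dist_comm]
    exact (hi a).le
  calc dist (∫ a, F i a ∂μ) c
      = |∫ a, (F i a - c) ∂μ| := by
        rw [integral_sub hFi (integrable_const c), Real.dist_eq]
        simp
    _ ≤ ε / 2 := by
        simpa using norm_integral_le_of_norm_le_const (μ := μ) (f := fun a => F i a - c)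
          (.of_forall h_le)
    _ < ε := half_lt_self hε

lemma HasPoissonVoids.isStationary (hS : HasPoissonVoids lam S P) (hlam : 0 < lam) :
    IsStationary (semigroup P S) (stationaryState P S) where
  isProbabilityMeasure := hS.isProbabilityMeasure_stationaryState
  invariant f hf t ht := by
    have η : Conf (Space d) := Conf.ofSet ∅
    have h_lim := (hS.tendstoUniformly_semigroup hlam
      (hf.semigroup (P := P) hS.measurable ht)).tendsto_at η
    have h_lim' := ((hS.tendstoUniformly_semigroup hlam hf).tendsto_at η).comp
      (tendsto_atTop_add_const_right _ t tendsto_id)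
    refine tendsto_nhds_unique h_lim (h_lim'.congr' ?_)
    filter_upwards [eventually_ge_atTop 0] with s hs
    exact congrFun (hS.semigroup_add hf hs ht) η

lemma isBoundedLocal_indicator_void {A : Set (Space d)} (hA : MeasurableSet A)
    (hA' : IsBounded A) :
    IsBoundedLocal ({η : Conf (Space d) | η.1 ∩ A = ∅}.indicator fun _ => (1 : ℝ)) where
  measurable := measurable_const.indicator (Conf.measurableSet_void hA)
  bounded := ⟨1, fun η => by by_cases h : η.1 ∩ A = ∅ <;> simp [Set.indicator, h]⟩
  finite_support := ⟨A, hA', fun η ξ h => by simp only [Set.indicator, Set.mem_ofPred_eq, h]⟩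

lemma HasPoissonVoids.eq_stationaryState (hS : HasPoissonVoids lam S P) (hlam : 0 < lam)
    {μ : Measure (Conf (Space d))} (hμ : IsStationary (semigroup P S) μ) :
    μ = stationaryState P S := by
  have := hμ.isProbabilityMeasure
  have := hS.isProbabilityMeasure_stationaryState
  refine Conf.measure_ext fun A hA hA' => ?_
  have hf := isBoundedLocal_indicator_void hA hA'
  have h_lim := tendsto_integral_of_tendstoUniformly_const (μ := μ)
    ((eventually_ge_atTop 0).mono fun t ht =>
      (hf.semigroup (P := P) hS.measurable ht).integrable_comp measurable_id)
    (hS.tendstoUniformly_semigroup hlam hf)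
  have h_const := tendsto_const_nhds.congr' ((eventually_ge_atTop 0).mono fun t ht =>
    (hμ.invariant _ hf t ht).symm)
  simpa [integral_indicator_const _ (Conf.measurableSet_void hA)] using
    tendsto_nhds_unique h_const h_lim

end Semigroup

/-! ### Campbell's formula -/

section Campbell

lemma hasSum_poisson_mul_descFactorial (r : ℝ) (k : ℕ) :
    HasSum (fun n : ℕ => Real.exp (-r) * r ^ n / n.factorial * n.descFactorial k) (r ^ k) := by
  have h_shift (n : ℕ) :
      Real.exp (-r) * r ^ (n + k) / (n + k).factorial * ((n + k).descFactorial k : ℕ) =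
        r ^ k * Real.exp (-r) * (r ^ n / n.factorial) := by
    rw [← Nat.factorial_mul_descFactorial (Nat.le_add_left k n), Nat.add_sub_cancel, Nat.cast_mul,
      pow_add]
    have h_ne : ((n + k).descFactorial k : ℝ) ≠ 0 :=
      Nat.cast_ne_zero.2 (Nat.descFactorial_pos.2 (Nat.le_add_left k n)).ne'
    field_simp
  have h_initial : ∑ n ∈ Finset.range k,
      Real.exp (-r) * r ^ n / n.factorial * n.descFactorial k = 0 :=
    Finset.sum_eq_zero fun n hn => by
      rw [Nat.descFactorial_of_lt (Finset.mem_range.1 hn), Nat.cast_zero, mul_zero]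
  have h_exp : HasSum (fun n : ℕ => r ^ k * Real.exp (-r) * (r ^ n / n.factorial)) (r ^ k) := by
    simpa [← Real.exp_eq_exp_ℝ, mul_assoc, ← Real.exp_add] using
      (NormedSpace.expSeries_div_hasSum_exp r).mul_left (r ^ k * Real.exp (-r))
  rw [← hasSum_nat_add_iff' k, h_initial, sub_zero]
  simpa only [h_shift] using h_exp

lemma integrable_descFactorial_poissonMeasure (r : ℝ≥0) (k : ℕ) :
    Integrable (fun n : ℕ => (n.descFactorial k : ℝ)) (poissonMeasure r) := by
  simpa [integrable_poissonMeasure_iff] using (hasSum_poisson_mul_descFactorial r k).summable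

lemma integral_descFactorial_poissonMeasure (r : ℝ≥0) (k : ℕ) :
    ∫ n : ℕ, (n.descFactorial k : ℝ) ∂(poissonMeasure r) = (r : ℝ) ^ k := by
  simpa [integral_poissonMeasure] using (hasSum_poisson_mul_descFactorial r k).tsum_eq

lemma lintegral_natCast_poissonMeasure (r : ℝ≥0) :
    ∫⁻ n : ℕ, (n : ENNReal) ∂(poissonMeasure r) = r := by
  have h_int : Integrable (fun n : ℕ => (n : ℝ)) (poissonMeasure r) := by
    simpa using integrable_descFactorial_poissonMeasure r 1
  have h_mean : ∫ n : ℕ, (n : ℝ) ∂(poissonMeasure r) = r := by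
    simpa using integral_descFactorial_poissonMeasure r 1
  simpa [h_mean] using
    (ofReal_integral_eq_lintegral_ofReal h_int (.of_forall fun n => n.cast_nonneg)).symm

variable {X : Type*} [MetricSpace X]

lemma countKernel_restrict_apply [MeasurableSpace X] [MeasurableSingletonClass X] (η : Conf X)
    {A : Set X} (hA : MeasurableSet A) :
    (countKernel X η).restrict A = Measure.count.restrict (η.1 ∩ A) := by
  rw [Set.inter_comm]
  exact Measure.restrict_restrict hA

lemma countKernel_real_apply [MeasurableSpace X] [MeasurableSingletonClass X] (η : Conf X)
    {A : Set X} (hA : MeasurableSet A) : (countKernel X η).real A = (η.1 ∩ A).ncard := by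
  rw [measureReal_def, countKernel_apply η hA, Set.ncard]
  cases (η.1 ∩ A).encard <;> simp

variable [MeasureSpace X] {Ω : Type*} [MeasurableSpace Ω] {P : Measure Ω} {lam : ℝ}
  {S : Ω → Conf X}

lemma IsPoissonProcess.integrable_descFactorial_ncard (hS : IsPoissonProcess lam S P) {A : Set X}
    (hA : MeasurableSet A) (hA' : IsBounded A) (k : ℕ) :
    Integrable (fun ω => (((S ω).1 ∩ A).ncard.descFactorial k : ℝ)) P := by
  have h := integrable_descFactorial_poissonMeasure (lam.toNNReal * (volume A).toNNReal) k
  rw [← hS.law_count A hA hA'] at h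
  exact h.comp_measurable (hS.measurable_ncard hA)

lemma IsPoissonProcess.integral_descFactorial_ncard (hS : IsPoissonProcess lam S P)
    (hlam : 0 ≤ lam) {A : Set X} (hA : MeasurableSet A) (hA' : IsBounded A) (k : ℕ) :
    ∫ ω, (((S ω).1 ∩ A).ncard.descFactorial k : ℝ) ∂P = (lam * volume.real A) ^ k := by
  rw [← integral_map (f := fun n : ℕ => (n.descFactorial k : ℝ))
    (hS.measurable_ncard hA).aemeasurable (measurable_of_countable _).aestronglyMeasurable,
    hS.law_count A hA hA', integral_descFactorial_poissonMeasure, NNReal.coe_mul,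
    Real.coe_toNNReal _ hlam]
  rfl

variable [BorelSpace X] [ProperSpace X] [IsLocallyFiniteMeasure (volume : Measure X)]

lemma IsPoissonProcess.countKernel_comp_map_apply (hS : IsPoissonProcess lam S P) {A : Set X}
    (hA : MeasurableSet A) (hA' : IsBounded A) :
    (countKernel X ∘ₘ P.map S) A = ENNReal.ofReal lam * volume A := by
  have h_count (ω : Ω) : countKernel X (S ω) A = (((S ω).1 ∩ A).ncard : ENNReal) := by
    rw [countKernel_apply (S ω) hA, ← ((S ω).finite_inter hA').cast_ncard_eq]
    simp
  calc (countKernel X ∘ₘ P.map S) A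
      = ∫⁻ ω, (((S ω).1 ∩ A).ncard : ENNReal) ∂P := by
        rw [Measure.bind_apply hA (countKernel X).aemeasurable,
          lintegral_map ((countKernel X).measurable_coe hA) hS.measurable]
        simp only [h_count]
    _ = ENNReal.ofReal lam * volume A := by
        rw [← lintegral_map (f := fun n : ℕ => (n : ENNReal)) (measurable_of_countable _)
          (hS.measurable_ncard hA), hS.law_count A hA hA', lintegral_natCast_poissonMeasure,
          ENNReal.coe_mul, ENNReal.coe_toNNReal hA'.measure_lt_top.ne, ENNReal.ofReal]

lemma IsPoissonProcess.countKernel_comp_map (hS : IsPoissonProcess lam S P) :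
    countKernel X ∘ₘ P.map S = ENNReal.ofReal lam • volume := by
  obtain hX | ⟨⟨x₀⟩⟩ := isEmpty_or_nonempty X
  · exact Subsingleton.elim _ _
  refine (Measure.ext_iff_of_iUnion_eq_univ (Metric.iUnion_closedBall_nat x₀)).2 fun n => ?_
  ext A hA
  have h_bdd : IsBounded (A ∩ Metric.closedBall x₀ n) :=
    Metric.isBounded_closedBall.subset Set.inter_subset_right
  rw [Measure.restrict_apply hA, Measure.restrict_apply hA,
    hS.countKernel_comp_map_apply (hA.inter measurableSet_closedBall) h_bdd, Measure.smul_apply,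
    smul_eq_mul]

lemma IsPoissonProcess.integrable_countKernel_comp (hS : IsPoissonProcess lam S P) {g : X → ℝ}
    (hg : Integrable g) :
    Integrable g ((countKernel X ∘ₖ Kernel.const Unit (P.map S)) ()) := by
  rw [← Measure.comp_eq_comp_const_apply, hS.countKernel_comp_map]
  exact hg.smul_measure ENNReal.ofReal_ne_top

lemma IsPoissonProcess.integrable_integral_countKernel (hS : IsPoissonProcess lam S P) {g : X → ℝ}
    (hg : Integrable g) : Integrable (fun ω => ∫ x, g x ∂(countKernel X (S ω))) P :=
  (hS.integrable_countKernel_comp hg).integral_comp.comp_measurable hS.measurable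

lemma IsPoissonProcess.integral_integral_countKernel (hS : IsPoissonProcess lam S P)
    (hlam : 0 ≤ lam) {g : X → ℝ} (hg : Integrable g) :
    ∫ ω, ∫ x, g x ∂(countKernel X (S ω)) ∂P = lam * ∫ x, g x := by
  have h := hS.integrable_countKernel_comp hg
  calc ∫ ω, ∫ x, g x ∂(countKernel X (S ω)) ∂P
      = ∫ η, ∫ x, g x ∂(countKernel X η) ∂(P.map S) :=
        (integral_map hS.measurable.aemeasurable h.integral_comp.aestronglyMeasurable).symm
    _ = ∫ x, g x ∂(countKernel X ∘ₘ P.map S) := by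
        rw [Measure.comp_eq_comp_const_apply]
        exact (Kernel.integral_comp h).symm
    _ = lam * ∫ x, g x := by
        rw [hS.countKernel_comp_map, integral_smul_measure, ENNReal.toReal_ofReal hlam, smul_eq_mul]

end Campbell

/-! ### The generator -/

section Generator

variable {d : ℕ}

section Local

variable {Λ W : Set (Space d)}

lemma mem_update {η : Conf (Space d)} {u y : Space d} :
    y ∈ (update η u).1 ↔ (y ∈ η.1 ∧ ¬ dist y u ≤ 1) ∨ y = u := Iff.rfl

lemma update_inter_eq_of_notMem (hW : ∀ y ∈ Λ, Metric.closedBall y 1 ⊆ W) (η : Conf (Space d))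
    {u : Space d} (hu : u ∉ W) : (update η u).1 ∩ Λ = η.1 ∩ Λ := by
  ext y
  refine and_congr_left fun hy => ?_
  have h_far : ¬ dist y u ≤ 1 := fun h => hu (hW y hy (Metric.mem_closedBall'.2 h))
  have h_ne : y ≠ u := fun h => h_far (by simp [h])
  rw [mem_update]
  tauto

variable {S : Conf (Space d × ℝ)} {h : ℝ}

lemma covered_iff_exists_mem_inter (hW : ∀ y ∈ Λ, Metric.closedBall y 1 ⊆ W) {y : Space d}
    (hy : y ∈ Λ) {a : ℝ} (ha : 0 ≤ a) :
    Covered S.1 y a h ↔ ∃ p ∈ S.1 ∩ W ×ˢ Set.Ioc 0 h, a < p.2 ∧ dist y p.1 ≤ 1 := by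
  constructor
  · rintro ⟨p, hp, hap, hph, hyp⟩
    exact ⟨p, ⟨hp, hW y hy (Metric.mem_closedBall'.2 hyp), ha.trans_lt hap, hph⟩, hap, hyp⟩
  · rintro ⟨p, ⟨hp, -, -, hph⟩, hap, hyp⟩
    exact ⟨p, hp, hap, hph, hyp⟩

lemma mem_evolve_iff_of_mem (h_ne : ∀ p ∈ S.1, p.2 ≠ 0) (hh : 0 ≤ h)
    (hW : ∀ y ∈ Λ, Metric.closedBall y 1 ⊆ W) (η : Conf (Space d)) {y : Space d} (hy : y ∈ Λ) :
    y ∈ (evolve h S η).1 ↔ (y ∈ η.1 ∧ ¬ Covered S.1 y 0 h) ∨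
      ∃ r, (y, r) ∈ S.1 ∩ W ×ˢ Set.Ioc 0 h ∧ ¬ Covered S.1 y r h := by
  rw [mem_evolve hh]
  refine or_congr_right (exists_congr fun r => ?_)
  have hyW : y ∈ W := hW y hy (Metric.mem_closedBall_self zero_le_one)
  constructor
  · rintro ⟨h_mem, hr, hrh, h_cov⟩
    exact ⟨⟨h_mem, hyW, hr.lt_of_ne (h_ne _ h_mem).symm, hrh⟩, h_cov⟩
  · rintro ⟨⟨h_mem, -, hr, hrh⟩, h_cov⟩
    exact ⟨h_mem, hr.le, hrh, h_cov⟩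

lemma evolve_inter_eq_of_empty (h_ne : ∀ p ∈ S.1, p.2 ≠ 0) (hh : 0 ≤ h)
    (hW : ∀ y ∈ Λ, Metric.closedBall y 1 ⊆ W) (hS : S.1 ∩ W ×ˢ Set.Ioc 0 h = ∅)
    (η : Conf (Space d)) : (evolve h S η).1 ∩ Λ = η.1 ∩ Λ := by
  ext y
  refine and_congr_left fun hy => ?_
  rw [mem_evolve_iff_of_mem h_ne hh hW η hy, covered_iff_exists_mem_inter hW hy le_rfl, hS]
  simp

lemma evolve_inter_eq_of_singleton (h_ne : ∀ p ∈ S.1, p.2 ≠ 0) (hh : 0 ≤ h)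
    (hW : ∀ y ∈ Λ, Metric.closedBall y 1 ⊆ W) {p : Space d × ℝ}
    (hS : S.1 ∩ W ×ˢ Set.Ioc 0 h = {p}) (η : Conf (Space d)) :
    (evolve h S η).1 ∩ Λ = (update η p.1).1 ∩ Λ := by
  have hp : 0 < p.2 := (hS.ge (Set.mem_singleton p)).2.2.1
  ext y
  refine and_congr_left fun hy => ?_
  have h_covered {a : ℝ} (ha : 0 ≤ a) : Covered S.1 y a h ↔ a < p.2 ∧ dist y p.1 ≤ 1 := by
    rw [covered_iff_exists_mem_inter hW hy ha, hS]
    simp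
  have h_new : (∃ r, (y, r) ∈ ({p} : Set (Space d × ℝ)) ∧ ¬ Covered S.1 y r h) ↔ y = p.1 := by
    constructor
    · rintro ⟨r, hr, -⟩
      exact congrArg Prod.fst hr
    · rintro rfl
      exact ⟨p.2, rfl, fun h => lt_irrefl _ ((h_covered hp.le).1 h).1⟩
  rw [mem_evolve_iff_of_mem h_ne hh hW η hy, mem_update, h_covered le_rfl, hS, h_new]
  simp only [hp, true_and]

end Local

section FirstOrder

variable {f : Conf (Space d) → ℝ} {M : ℝ} {Λ W : Set (Space d)}

lemma IsBoundedLocal.integrable_update_sub (hf : IsBoundedLocal f)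
    (hΛ : ∀ η ξ : Conf (Space d), η.1 ∩ Λ = ξ.1 ∩ Λ → f η = f ξ)
    (hW : ∀ y ∈ Λ, Metric.closedBall y 1 ⊆ W) (hW' : IsBounded W)
    (η : Conf (Space d)) : Integrable fun u => f (PoissonTree.update η u) - f η := by
  obtain ⟨M, hM⟩ := hf.bounded
  refine (integrableOn_iff_integrable_of_support_subset (s := W) fun u hu => ?_).1
    (Measure.integrableOn_of_bounded (M := 2 * M) hW'.measure_lt_top.ne
      ((hf.measurable.comp (measurable_update η)).sub_const _).aestronglyMeasurable
      (.of_forall fun u => abs_sub_le_two_mul (hM _) (hM _)))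
  by_contra hu'
  exact hu (sub_eq_zero.2 (hΛ _ _ (update_inter_eq_of_notMem hW η hu')))

/-- The first order approximation of `f (evolve h S η)` for small `h`: each point of `S` in the
region `A` of space-time acts on `η` separately. -/
noncomputable def firstOrder (f : Conf (Space d) → ℝ) (A : Set (Space d × ℝ))
    (S : Conf (Space d × ℝ)) (η : Conf (Space d)) : ℝ :=
  f η + ∫ p in A, (f (update η p.1) - f η) ∂(countKernel _ S)

lemma abs_evolve_sub_firstOrder_le {S : Conf (Space d × ℝ)} {h : ℝ}
    (hM : ∀ η, |f η| ≤ M) (hΛ : ∀ η ξ : Conf (Space d), η.1 ∩ Λ = ξ.1 ∩ Λ → f η = f ξ)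
    (hW : ∀ y ∈ Λ, Metric.closedBall y 1 ⊆ W) (hW' : IsBounded W) (hW_meas : MeasurableSet W)
    (h_ne : ∀ p ∈ S.1, p.2 ≠ 0) (hh : 0 ≤ h) (η : Conf (Space d)) :
    |f (evolve h S η) - firstOrder f (W ×ˢ Set.Ioc 0 h) S η| ≤
      3 * M * (S.1 ∩ W ×ˢ Set.Ioc 0 h).ncard.descFactorial 2 := by
  have hA : MeasurableSet (W ×ˢ Set.Ioc 0 h) := hW_meas.prod measurableSet_Ioc
  have hA' : IsBounded (W ×ˢ Set.Ioc 0 h) := hW'.prod (Metric.isBounded_Ioc 0 h)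
  have hM0 : 0 ≤ M := (abs_nonneg _).trans (hM η)
  rw [firstOrder]
  obtain h_zero | h_one | h_two : (S.1 ∩ W ×ˢ Set.Ioc 0 h).ncard = 0 ∨
      (S.1 ∩ W ×ˢ Set.Ioc 0 h).ncard = 1 ∨ 2 ≤ (S.1 ∩ W ×ˢ Set.Ioc 0 h).ncard := by omega
  · have h_empty := (Set.ncard_eq_zero (S.finite_inter hA')).1 h_zero
    rw [hΛ _ _ (evolve_inter_eq_of_empty h_ne hh hW h_empty η), countKernel_restrict_apply S hA,
      h_empty]
    simp
  · obtain ⟨p, hp⟩ := Set.ncard_eq_one.1 h_one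
    rw [hΛ _ _ (evolve_inter_eq_of_singleton h_ne hh hW hp η), countKernel_restrict_apply S hA, hp]
    simp [Measure.restrict_singleton]
  · have h_sum : |∫ p in W ×ˢ Set.Ioc 0 h, (f (update η p.1) - f η) ∂(countKernel _ S)| ≤
        2 * M * (S.1 ∩ W ×ˢ Set.Ioc 0 h).ncard := by
      rw [← countKernel_real_apply S hA]
      exact norm_setIntegral_le_of_norm_le_const
        (f := fun p : Space d × ℝ => f (update η p.1) - f η) (countKernel_lt_top S hA hA')
        fun p _ => abs_sub_le_two_mul (hM _) (hM _)
    have h_two' : (2 : ℝ) ≤ (S.1 ∩ W ×ˢ Set.Ioc 0 h).ncard := by exact_mod_cast h_two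
    rw [← sub_sub]
    refine (abs_sub _ _).trans ((add_le_add (abs_sub_le_two_mul (hM _) (hM _)) h_sum).trans ?_)
    rw [Nat.cast_descFactorial_two]
    nlinarith [mul_nonneg hM0 (sub_nonneg.2 h_two')]

variable {Ω : Type*} [MeasurableSpace Ω] {P : Measure Ω} {lam : ℝ} {S : Ω → Conf (Space d × ℝ)}

lemma firstOrder_eq_add_integral_indicator {A : Set (Space d × ℝ)} (hA : MeasurableSet A)
    (S : Conf (Space d × ℝ)) (η : Conf (Space d)) :
    firstOrder f A S η =
      f η + ∫ p, A.indicator (fun p => f (update η p.1) - f η) p ∂(countKernel _ S) := by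
  rw [firstOrder, integral_indicator hA]

lemma integrable_indicator_comp_fst {g : Space d → ℝ} (hg : Integrable g) (hW : MeasurableSet W)
    (h : ℝ) : Integrable ((W ×ˢ Set.Ioc 0 h).indicator fun p : Space d × ℝ => g p.1) := by
  rw [integrable_indicator_iff (hW.prod measurableSet_Ioc), IntegrableOn, Measure.volume_eq_prod,
    ← Measure.prod_restrict]
  exact hg.restrict.comp_fst _

lemma IsPoissonProcess.integrable_firstOrder (hS : IsPoissonProcess lam S P) [IsFiniteMeasure P]
    {η : Conf (Space d)} (hf : Integrable fun u => f (update η u) - f η) (hW : MeasurableSet W)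
    (h : ℝ) : Integrable (fun ω => firstOrder f (W ×ˢ Set.Ioc 0 h) (S ω) η) P := by
  simp only [firstOrder_eq_add_integral_indicator (hW.prod measurableSet_Ioc)]
  exact (integrable_const _).add
    (hS.integrable_integral_countKernel (integrable_indicator_comp_fst hf hW h))

lemma IsPoissonProcess.integral_firstOrder (hS : IsPoissonProcess lam S P) [IsProbabilityMeasure P]
    (hlam : 0 ≤ lam) {η : Conf (Space d)} (hf : Integrable fun u => f (update η u) - f η)
    (hW : MeasurableSet W) (hfW : ∀ u ∉ W, f (update η u) = f η) {h : ℝ} (hh : 0 ≤ h) :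
    ∫ ω, firstOrder f (W ×ˢ Set.Ioc 0 h) (S ω) η ∂P = f η + h * generator lam f η := by
  have hA : MeasurableSet (W ×ˢ Set.Ioc 0 h) := hW.prod measurableSet_Ioc
  have hg := integrable_indicator_comp_fst hf hW h
  have h_volume : ∫ p in W ×ˢ Set.Ioc 0 h, (f (update η p.1) - f η) =
      h * ∫ u, (f (update η u) - f η) := by
    rw [Measure.volume_eq_prod, ← Measure.prod_restrict,
      integral_fun_fst (fun u => f (update η u) - f η), measureReal_restrict_apply_univ,
      Real.volume_real_Ioc_of_le hh, sub_zero, smul_eq_mul,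
      setIntegral_eq_integral_of_forall_compl_eq_zero fun u hu => sub_eq_zero.2 (hfW u hu)]
  simp only [firstOrder_eq_add_integral_indicator hA]
  rw [integral_add (integrable_const _) (hS.integrable_integral_countKernel hg),
    hS.integral_integral_countKernel hlam hg, integral_indicator hA, h_volume, generator,
    integral_const, probReal_univ, one_smul, mul_left_comm]

lemma IsPoissonProcess.abs_semigroup_sub_add_mul_generator_le [IsProbabilityMeasure P]
    (hS : IsPoissonProcess lam S P) (hlam : 0 ≤ lam) (hf : IsBoundedLocal f)
    (hM : ∀ η, |f η| ≤ M) (hΛ : ∀ η ξ : Conf (Space d), η.1 ∩ Λ = ξ.1 ∩ Λ → f η = f ξ)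
    (hW : ∀ y ∈ Λ, Metric.closedBall y 1 ⊆ W) (hW' : IsBounded W) (hW_meas : MeasurableSet W)
    {h : ℝ} (hh : 0 ≤ h) (η : Conf (Space d)) :
    |semigroup P S h f η - (f η + h * generator lam f η)| ≤
      3 * M * (lam * volume.real W * h) ^ 2 := by
  have hA : MeasurableSet (W ×ˢ Set.Ioc 0 h) := hW_meas.prod measurableSet_Ioc
  have hA' : IsBounded (W ×ˢ Set.Ioc 0 h) := hW'.prod (Metric.isBounded_Ioc 0 h)
  have h_update := hf.integrable_update_sub hΛ hW hW' η
  have h_evolve := hf.integrable_comp (μ := P) (measurable_evolve_comp hh hS.measurable η)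
  rw [← hS.integral_firstOrder hlam h_update hW_meas
    (fun u hu => hΛ _ _ (update_inter_eq_of_notMem hW η hu)) hh, semigroup_eq_integral_evolve,
    ← integral_sub h_evolve (hS.integrable_firstOrder h_update hW_meas h)]
  calc |∫ ω, (f (evolve h (S ω) η) - firstOrder f (W ×ˢ Set.Ioc 0 h) (S ω) η) ∂P|
      ≤ ∫ ω, 3 * M * (((S ω).1 ∩ W ×ˢ Set.Ioc 0 h).ncard.descFactorial 2 : ℝ) ∂P := by
        refine norm_integral_le_of_norm_le
          (f := fun ω => f (evolve h (S ω) η) - firstOrder f (W ×ˢ Set.Ioc 0 h) (S ω) η)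
          ((hS.integrable_descFactorial_ncard hA hA' 2).const_mul _) ?_
        filter_upwards [(hS.hasPoissonVoids hlam).ae_time_ne 0] with ω h_ne
        exact abs_evolve_sub_firstOrder_le hM hΛ hW hW' hW_meas h_ne hh η
    _ = 3 * M * (lam * volume.real W * h) ^ 2 := by
        rw [integral_const_mul, hS.integral_descFactorial_ncard hlam hA hA', Measure.volume_eq_prod,
          measureReal_prod_prod, Real.volume_real_Ioc_of_le hh, sub_zero, mul_assoc lam]

lemma IsPoissonProcess.tendstoUniformly_generator [IsProbabilityMeasure P]
    (hS : IsPoissonProcess lam S P) (hlam : 0 ≤ lam) (hf : IsBoundedLocal f) :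
    TendstoUniformly (fun h η => (semigroup P S h f η - f η) / h) (generator lam f) (𝓝[>] 0) := by
  obtain ⟨M, hM⟩ := hf.bounded
  obtain ⟨Λ, hΛ_bdd, hΛ⟩ := hf.finite_support
  have hW (y) (hy : y ∈ Λ) : Metric.closedBall y 1 ⊆ Metric.cthickening 1 Λ :=
    Metric.closedBall_subset_cthickening hy 1
  have h_lim : Tendsto (fun h : ℝ => 3 * M * (lam * volume.real (Metric.cthickening 1 Λ)) ^ 2 * h)
      (𝓝[>] 0) (𝓝 0) := by
    exact tendsto_nhdsWithin_of_tendsto_nhds (Continuous.tendsto' (by fun_prop) _ _ (mul_zero _))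
  rw [Metric.tendstoUniformly_iff]
  intro ε hε
  filter_upwards [h_lim.eventually_lt_const hε, self_mem_nhdsWithin] with h h_lt hh η
  have hh : 0 < h := hh
  have h_le := hS.abs_semigroup_sub_add_mul_generator_le hlam hf hM hΛ hW hΛ_bdd.cthickening
    Metric.isClosed_cthickening.measurableSet hh.le η
  calc dist (generator lam f η) ((semigroup P S h f η - f η) / h)
      = |semigroup P S h f η - (f η + h * generator lam f η)| / h := by
        rw [dist_comm, Real.dist_eq, ← abs_of_pos hh, ← abs_div, abs_of_pos hh]
        congr 1
        field_simp
        ring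
    _ ≤ 3 * M * (lam * volume.real (Metric.cthickening 1 Λ) * h) ^ 2 / h := by gcongr
    _ = 3 * M * (lam * volume.real (Metric.cthickening 1 Λ)) ^ 2 * h := by field_simp
    _ < ε := h_lt

lemma IsPoissonProcess.isSemigroupWithGenerator [IsProbabilityMeasure P]
    (hS : IsPoissonProcess lam S P) (hlam : 0 ≤ lam) :
    IsSemigroupWithGenerator (semigroup P S) (generator lam) where
  maps_to _ hf _ ht := hf.semigroup hS.measurable ht
  zero f _ := (hS.hasPoissonVoids hlam).semigroup_zero f
  add _ hf _ _ hs ht := (hS.hasPoissonVoids hlam).semigroup_add hf hs ht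
  deriv _ hf := hS.tendstoUniformly_generator hlam hf

end FirstOrder

end Generator

end PoissonTree

theorem corollary4p2 (d : ℕ) (hd : 2 ≤ d) :
    ∃ Cd : ℝ, 0 < Cd ∧ ∃ C : (PoissonTree.Conf (PoissonTree.Space d) → ℝ) → ℝ,
      ∀ lam : ℝ, 0 < lam →
      ∀ (Ω : Type*) [MeasurableSpace Ω] (P : Measure Ω) [IsProbabilityMeasure P]
        (S : Ω → PoissonTree.Conf (PoissonTree.Space d × ℝ)),
        PoissonTree.IsPoissonProcess lam S P →
          PoissonTree.IsSemigroupWithGenerator (PoissonTree.semigroup P S)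
            (PoissonTree.generator lam) ∧
          PoissonTree.IsStationary (PoissonTree.semigroup P S)
            (PoissonTree.stationaryState P S) ∧
          (∀ μ : Measure (PoissonTree.Conf (PoissonTree.Space d)),
            PoissonTree.IsStationary (PoissonTree.semigroup P S) μ →
              μ = PoissonTree.stationaryState P S) ∧
          ∀ f : PoissonTree.Conf (PoissonTree.Space d) → ℝ, PoissonTree.IsBoundedLocal f →
            ∀ t : ℝ, 0 ≤ t → ∀ η : PoissonTree.Conf (PoissonTree.Space d),
              |PoissonTree.semigroup P S t f η - ∫ ξ, f ξ ∂(PoissonTree.stationaryState P S)|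
                ≤ C f * Real.exp (-(Cd * lam * t)) := by
  choose! C hC using fun f (hf : PoissonTree.IsBoundedLocal (d := d) f) =>
    hf.exists_forall_abs_semigroup_sub_le
  refine ⟨PoissonTree.halfBallVolume d, PoissonTree.halfBallVolume_pos d, C, ?_⟩
  intro lam hlam Ω _ P _ S hS
  have hV := hS.hasPoissonVoids hlam.le
  exact ⟨hS.isSemigroupWithGenerator hlam.le, hV.isStationary hlam,
    fun _ hμ => hV.eq_stationaryState hlam hμ, fun f hf => hC f hf lam hlam Ω P S hV⟩
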